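/- **Model.** For $n\ge 1$, $\sigma>0$, $p,q\in[0,1]$ and $\mu,\nu\in\mathbb R^d$ with $\|\mu\|_2=\|\nu\|_2$ and $\langle\mu,\nu\rangle=0$, let $(A,X)\sim\text{XOR-CSBM}(n,d,\mu,\nu,\sigma^2,p,q)$: the bits $\varepsilon_1,\dots,\varepsilon_n,\eta_1,\dots,\eta_n$ are independent $\mathrm{Ber}(1/2)$. Given them, the rows $X_i\sim\mathcal N\big((2\eta_i-1)((1-\varepsilon_i)\mu+\varepsilon_i\nu),\sigma^2I_d\big)$ of $X\in\mathbb R^{n\times d}$ and the entries $a_{ij}=a_{ji}$, $i\le j$, of the adjacency matrix $A$ are independent. For $i\ne j$, $a_{ij}\sim\mathrm{Ber}(p)$ if $\varepsilon_i=\varepsilon_j$ and $a_{ij}\sim\mathrm{Ber}(q)$ otherwise; the self-loops are $a_{ii}\sim\mathrm{Ber}(s)$ with an arbitrary $s\in[0,1]$ ($s=1$: every node has a self-loop; $s=p$: self-loops are drawn like intra-class edges). The class of node $i$ is $y_i=\varepsilon_i$. Let $D$ be the diagonal matrix of the degrees $\sum_j a_{ij}$ (with $1/0:=0$). **Networks.**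 An $L$-layer network with parameters $\theta=(W^{(l)},b^{(l)})_{l\le L}$ and $k_l$ graph convolutions in layer $l$ computes $H^{(0)}=X$, $f^{(l)}=(D^{-1}A)^{k_l}H^{(l-1)}W^{(l)}+b^{(l)}$, $H^{(l)}=\mathrm{ReLU}(f^{(l)})$ and $\hat y=\mathrm{sigmoid}(f^{(L)})\in(0,1)^n$. It perfectly classifies the data if, for all $i$, $\hat y_i\ge\frac12$ exactly when $y_i=1$. Its loss is $\ell_\theta(A,X)=-\frac1n\sum_i\big(y_i\log\hat y_i+(1-y_i)\log(1-\hat y_i)\big)$. For $R>0$, $\theta$ is feasible if, in spectral norm, $\|W^{(1)}\|_2\le R$ and $\|W^{(l)}\|_2\le1$ for $l>1$. No convolution is placed in the first layer ($k_1=0$). **Theorem.** There are a continuous function $C:[0,\infty)\to(0,\infty)$ and a number $c_0>0$ with $C(r)\ge c_0/(1+r)$ for all $r\ge 0$ such that the following holds. Let $\kappa_1,\kappa_2,\Gamma_0>0$. Write $\gamma=\|\mu-\nu\|_2$ and $C_{\gamma/\sigma}=C(\gamma/\sigma)$; thus $C_{\gamma/\sigma}$ lies between two positive constants as long as $\gamma=O(\sigma)$,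 and tends to the constant $C(0)>0$ if $\gamma/\sigma\to0$. Assume throughout that $\left|\frac{p-q}{p+q}\right|\ge\Gamma_0$. 1. Assume $p,q\ge\kappa_1\frac{\log^2 n}{n}$ and $\gamma\ge\kappa_2\frac{\sigma\sqrt{\log n}}{\sqrt[4]{n(p+q)}}$. Then there are a feasible two-layer network and a feasible three-layer network, whose parameters depend only on $\kappa_1,\kappa_2,\Gamma_0,d,\mu,\nu,R$ and the sign of $p-q$, such that for every $c>0$, with probability at least $1-O(n^{-c})$, both networks, with one graph convolution placed in the second layer (of either network) or in the third layer (of the three-layer network), perfectly classify the data and have the loss $$\ell_\theta(A,X)=C'\exp\left(-\frac{C_{\gamma/\sigma}R\gamma^2}{\sigma}\left|\frac{p-q}{p+q}\right|(1+\delta)\right),\qquad C'\in[\tfrac12,1],\quad|\delta|\le K\sqrt{\frac{1+c}{\log n}}.$$ 2. Assume $p,q\ge\kappa_1\frac{\log n}{\sqrt n}$ and $\gamma\ge\kappa_2\frac{\sigma\sqrt{\log n}}{\sqrt[4]{n}}$. Then there are a feasible two-layer network and a feasible three-layer network, whose parameters depend only on $\kappa_1,\kappa_2,\Gamma_0,d,\mu,\nu,R$,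 such that for every $c>0$, with probability at least $1-O(n^{-c})$, both networks, with two graph convolutions placed in any combination in the second and/or third layers, perfectly classify the data and have the loss $$\ell_\theta(A,X)=C'\exp\left(-\frac{C_{\gamma/\sigma}R\gamma^2}{\sigma}\left(\frac{p-q}{p+q}\right)^2(1+\delta)\right),\qquad C'\in[\tfrac12,1],\quad|\delta|\le K\sqrt{\frac{1+c}{\log n}}.$$ Here $K$ depends only on $\kappa_1,\kappa_2,\Gamma_0$ and the constant in $O(n^{-c})$ only on $\kappa_1,\kappa_2,\Gamma_0,c$; $C'$ and $\delta$ may depend on the sample, on the network and on the placement of the convolutions. -/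

import Mathlib

open MeasureTheory ProbabilityTheory
open scoped ENNReal

namespace XorCSBM

/-! ### The data model -/

/-- The unobserved labels: node `i` carries the pair `(ε i, η i)` of bits. The class of node `i` is
`ε i`; the bit `η i` is the sign of the mixture component. -/
abbrev Labels (n : ℕ) : Type := Fin n → Bool × Bool

/-- An undirected graph on `Fin n`, self-loops allowed: `e s(i, j)` says whether `i` and `j` are
joined by an edge. -/
abbrev Graph (n : ℕ) : Type := Sym2 (Fin n) → Bool

/-- A feature vector in `ℝ^d` for every node. -/
abbrev Features (n d : ℕ) : Type := Fin n → EuclideanSpace ℝ (Fin d)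

/-- A sample: labels, graph, and features. -/
abbrev Sample (n d : ℕ) : Type := Labels n × Graph n × Features n d

/-- The class labels `ε` of a sample. -/
def Sample.classes {n d : ℕ} (S : Sample n d) : Fin n → Bool := fun i => (S.1 i).1

/-- The graph of a sample. -/
def Sample.graph {n d : ℕ} (S : Sample n d) : Graph n := S.2.1

/-- The data matrix of a sample; its `i`-th row is the feature vector of node `i`. -/
def Sample.data {n d : ℕ} (S : Sample n d) : Matrix (Fin n) (Fin d) ℝ :=
  Matrix.of fun i k => S.2.2 i k

/-- The component mean `(2η - 1)((1 - ε)μ + εν)`. -/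
def componentMean {d : ℕ} (μ ν : EuclideanSpace ℝ (Fin d)) (ε η : Bool) :
    EuclideanSpace ℝ (Fin d) :=
  (if η then (1 : ℝ) else -1) • (if ε then ν else μ)

/-- The spherical Gaussian law `N(m, σ² I)` on `ℝ^d`. -/
noncomputable def sphericalGaussian {d : ℕ} (m : EuclideanSpace ℝ (Fin d)) (σ : ℝ) :
    Measure (EuclideanSpace ℝ (Fin d)) :=
  (stdGaussian (EuclideanSpace ℝ (Fin d))).map fun g => m + σ • g

/-- The probability of an edge between two nodes given the labels: `p` inside a class, `q` between
the two classes, and `s` for a self-loop. -/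
def edgeProb {n : ℕ} (p q s : unitInterval) (l : Labels n) : Sym2 (Fin n) → unitInterval :=
  Sym2.lift ⟨fun i j => if i = j then s else if (l i).1 = (l j).1 then p else q, by
    intro i j
    simp only [eq_comm]⟩

/-- The law of the graph given the labels: independent Bernoulli edges. -/
noncomputable def graphLaw {n : ℕ} (p q s : unitInterval) (l : Labels n) : Measure (Graph n) :=
  Measure.pi fun e => bernoulliMeasure true false (edgeProb p q s l e)

/-- The law of the features given the labels: independent spherical Gaussians. -/
noncomputable def featureLaw {n d : ℕ} (μ ν : EuclideanSpace ℝ (Fin d)) (σ : ℝ) (l : Labels n) :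
    Measure (Features n d) :=
  Measure.pi fun i => sphericalGaussian (componentMean μ ν (l i).1 (l i).2) σ

/-- The joint law of labels, graph and features under XOR-CSBM(`n, d, μ, ν, σ², p, q`) with
self-loop probability `s`: the labels are `2n` independent fair bits (each of the `4^n` values has
probability `4^(-n)`), and given the labels, the graph and the features are independent. -/
noncomputable def law (n d : ℕ) (μ ν : EuclideanSpace ℝ (Fin d)) (σ : ℝ)
    (p q s : unitInterval) : Measure (Sample n d) :=
  ∑ l : Labels n,
    ((4 : ℝ≥0∞) ^ n)⁻¹ • (Measure.dirac l).prod ((graphLaw p q s l).prod (featureLaw μ ν σ l))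

/-! ### Networks with graph convolutions -/

/-- The adjacency matrix `A` of a graph. -/
def adjacency {n : ℕ} (e : Graph n) : Matrix (Fin n) (Fin n) ℝ :=
  Matrix.of fun i j => if e s(i, j) then 1 else 0

/-- The degree of node `i`, the `i`-th row sum of `A`. -/
def degree {n : ℕ} (e : Graph n) (i : Fin n) : ℝ := ∑ j, adjacency e i j

/-- The graph convolution matrix `D⁻¹ A`. -/
noncomputable def convolution {n : ℕ} (e : Graph n) : Matrix (Fin n) (Fin n) ℝ :=
  Matrix.diagonal (fun i => (degree e i)⁻¹) * adjacency e

/-- The affine part of a layer with `k` graph convolutions: `(D⁻¹ A)^k H W + b`, the bias `b` being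
added to every row. -/
noncomputable def preactivation {n a b : ℕ} (e : Graph n) (k : ℕ) (H : Matrix (Fin n) (Fin a) ℝ)
    (W : Matrix (Fin a) (Fin b) ℝ) (bias : Fin b → ℝ) : Matrix (Fin n) (Fin b) ℝ :=
  convolution e ^ k * H * W + Matrix.of fun _ j => bias j

/-- Entrywise `ReLU`. -/
def relu {n a : ℕ} (H : Matrix (Fin n) (Fin a) ℝ) : Matrix (Fin n) (Fin a) ℝ :=
  H.map fun t => max t 0

/-- The parameters of a two-layer network on `ℝ^d` with scalar output. -/
structure TwoLayer (d : ℕ) where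
  /-- width of the hidden layer -/
  w : ℕ
  W₁ : Matrix (Fin d) (Fin w) ℝ
  b₁ : Fin w → ℝ
  W₂ : Matrix (Fin w) (Fin 1) ℝ
  b₂ : Fin 1 → ℝ

/-- The parameters of a three-layer network on `ℝ^d` with scalar output. -/
structure ThreeLayer (d : ℕ) where
  /-- width of the first hidden layer -/
  w : ℕ
  /-- width of the second hidden layer -/
  w' : ℕ
  W₁ : Matrix (Fin d) (Fin w) ℝ
  b₁ : Fin w → ℝ
  W₂ : Matrix (Fin w) (Fin w') ℝ
  b₂ : Fin w' → ℝ
  W₃ : Matrix (Fin w') (Fin 1) ℝ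
  b₃ : Fin 1 → ℝ

section Constraint

open scoped Matrix.Norms.L2Operator

/-- The constraint set, in spectral norm: `‖W₁‖₂ ≤ R` and `‖W₂‖₂ ≤ 1`. -/
def TwoLayer.Feasible {d : ℕ} (θ : TwoLayer d) (R : ℝ) : Prop :=
  ‖θ.W₁‖ ≤ R ∧ ‖θ.W₂‖ ≤ 1

/-- The constraint set, in spectral norm: `‖W₁‖₂ ≤ R`, `‖W₂‖₂ ≤ 1` and `‖W₃‖₂ ≤ 1`. -/
def ThreeLayer.Feasible {d : ℕ} (θ : ThreeLayer d) (R : ℝ) : Prop :=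
  ‖θ.W₁‖ ≤ R ∧ ‖θ.W₂‖ ≤ 1 ∧ ‖θ.W₃‖ ≤ 1

end Constraint

/-- The output `ŷ` of a two-layer network with `k₁`, `k₂` graph convolutions in its layers. -/
noncomputable def TwoLayer.output {n d : ℕ} (θ : TwoLayer d) (k₁ k₂ : ℕ) (e : Graph n)
    (X : Matrix (Fin n) (Fin d) ℝ) (i : Fin n) : ℝ :=
  Real.sigmoid (preactivation e k₂ (relu (preactivation e k₁ X θ.W₁ θ.b₁)) θ.W₂ θ.b₂ i 0)

/-- The output `ŷ` of a three-layer network with `k₁`, `k₂`, `k₃` graph convolutions in its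
layers. -/
noncomputable def ThreeLayer.output {n d : ℕ} (θ : ThreeLayer d) (k₁ k₂ k₃ : ℕ) (e : Graph n)
    (X : Matrix (Fin n) (Fin d) ℝ) (i : Fin n) : ℝ :=
  Real.sigmoid (preactivation e k₃ (relu (preactivation e k₂
    (relu (preactivation e k₁ X θ.W₁ θ.b₁)) θ.W₂ θ.b₂)) θ.W₃ θ.b₃ i 0)

/-- The binary cross-entropy loss of the outputs `out` for the labels `y`. -/
noncomputable def crossEntropy {n : ℕ} (y : Fin n → Bool) (out : Fin n → ℝ) : ℝ :=
  -(1 / (n : ℝ)) * ∑ i,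
    ((if y i then (1 : ℝ) else 0) * Real.log (out i) +
      (1 - if y i then (1 : ℝ) else 0) * Real.log (1 - out i))

/-- Perfect classification: the prediction, which is class `1` exactly when the output is at least
`1/2`, is correct at every node. -/
def Classifies {n : ℕ} (y : Fin n → Bool) (out : Fin n → ℝ) : Prop :=
  ∀ i, 1 / 2 ≤ out i ↔ y i = true

/-- The loss equals `C' exp(-E (1 ± err))` with `C' ∈ [1/2, 1]`. -/
def LossIs {n : ℕ} (y : Fin n → Bool) (out : Fin n → ℝ) (E err : ℝ) : Prop :=
  ∃ C' ∈ Set.Icc (1 / 2 : ℝ) 1, ∃ δ : ℝ, |δ| ≤ err ∧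
    crossEntropy y out = C' * Real.exp (-(E * (1 + δ)))

/-- On the sample `S`, the two networks, equipped with `K` graph convolutions distributed in any
way over the layers after the first one, classify all nodes correctly and have loss
`C' exp(-E (1 ± err))`. -/
def Succeed {n d : ℕ} (θ₂ : TwoLayer d) (θ₃ : ThreeLayer d) (K : ℕ) (E err : ℝ)
    (S : Sample n d) : Prop :=
  (Classifies S.classes (θ₂.output 0 K S.graph S.data) ∧
    LossIs S.classes (θ₂.output 0 K S.graph S.data) E err) ∧
  ∀ k₂ k₃ : ℕ, k₂ + k₃ = K →
    Classifies S.classes (θ₃.output 0 k₂ k₃ S.graph S.data) ∧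
    LossIs S.classes (θ₃.output 0 k₂ k₃ S.graph S.data) E err

end XorCSBM

namespace XorCSBM

open scoped Matrix NNReal

/-! ### The networks -/

section Norms

open scoped Matrix.Norms.L2Operator

lemma l2_opNorm_le_sum_col {a b : ℕ} (W : Matrix (Fin a) (Fin b) ℝ) :
    ‖W‖ ≤ ∑ j, ‖(WithLp.toLp 2 fun i => W i j : EuclideanSpace ℝ (Fin a))‖ := by
  rw [Matrix.l2_opNorm_def]
  refine ContinuousLinearMap.opNorm_le_bound _ (Finset.sum_nonneg fun _ _ => norm_nonneg _) ?_
  intro x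
  have hx : (Matrix.toEuclideanLin (𝕜 := ℝ) (m := Fin a) (n := Fin b) ≪≫ₗ
      LinearMap.toContinuousLinearMap) W x =
      ∑ j, x j • (WithLp.toLp 2 fun i => W i j : EuclideanSpace ℝ (Fin a)) := by
    ext i
    simp [Matrix.toEuclideanLin, Matrix.toLpLin, Matrix.mulVec, dotProduct, mul_comm]
  rw [hx, Finset.sum_mul]
  refine (norm_sum_le _ _).trans (Finset.sum_le_sum fun j _ => ?_)
  rw [norm_smul, mul_comm]
  gcongr
  exact PiLp.norm_apply_le x j

end Norms

/-- The unit vector in the direction of `v` (zero if `v = 0`). -/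
noncomputable def direction {d : ℕ} (v : EuclideanSpace ℝ (Fin d)) : EuclideanSpace ℝ (Fin d) :=
  ‖v‖⁻¹ • v

lemma norm_direction_le {d : ℕ} (v : EuclideanSpace ℝ (Fin d)) : ‖direction v‖ ≤ 1 := by
  rw [direction, norm_smul, norm_inv, norm_norm]
  exact inv_mul_le_one

/-- First-layer weights: the columns are `R/4` times `ν`, `-ν`, `μ`, `-μ`, normalized. -/
noncomputable def firstWeights {d : ℕ} (μ ν : EuclideanSpace ℝ (Fin d)) (R : ℝ) :
    Matrix (Fin d) (Fin 4) ℝ :=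
  Matrix.of fun k j => R / 4 *
    ![direction ν k, -direction ν k, direction μ k, -direction μ k] j

/-- Output weights of the two-layer network. -/
noncomputable def outputWeights (t : ℝ) : Matrix (Fin 4) (Fin 1) ℝ :=
  Matrix.of fun j _ => t / 8 * ![1, 1, -1, -1] j

/-- Second-layer weights of the three-layer network, summing the units belonging to one axis. -/
noncomputable def pairingWeights : Matrix (Fin 4) (Fin 2) ℝ :=
  !![1 / 4, 0; 1 / 4, 0; 0, 1 / 4; 0, 1 / 4]

/-- Third-layer weights of the three-layer network, taking a difference. -/
noncomputable def differenceWeights (t : ℝ) : Matrix (Fin 2) (Fin 1) ℝ :=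
  !![t / 2; -(t / 2)]

/-- The two-layer network with output sign `t`. -/
noncomputable def twoLayer {d : ℕ} (μ ν : EuclideanSpace ℝ (Fin d)) (R t : ℝ) : TwoLayer d where
  w := 4
  W₁ := firstWeights μ ν R
  b₁ := 0
  W₂ := outputWeights t
  b₂ := 0

/-- The three-layer network with output sign `t`. -/
noncomputable def threeLayer {d : ℕ} (μ ν : EuclideanSpace ℝ (Fin d)) (R t : ℝ) :
    ThreeLayer d where
  w := 4
  w' := 2
  W₁ := firstWeights μ ν R
  b₁ := 0
  W₂ := pairingWeights
  b₂ := 0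
  W₃ := differenceWeights t
  b₃ := 0

section Norms

open scoped Matrix.Norms.L2Operator

lemma norm_firstWeights_le {d : ℕ} (μ ν : EuclideanSpace ℝ (Fin d)) {R : ℝ} (hR : 0 ≤ R) :
    ‖firstWeights μ ν R‖ ≤ R := by
  refine (l2_opNorm_le_sum_col _).trans ?_
  have key (t : ℝ) (ht : |t| = 1) (v : EuclideanSpace ℝ (Fin d)) (g : Fin d → ℝ)
      (hg : ∀ k, g k = R / 4 * (t * direction v k)) :
      ‖(WithLp.toLp 2 g : EuclideanSpace ℝ (Fin d))‖ ≤ R / 4 := by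
    have : (WithLp.toLp 2 g : EuclideanSpace ℝ (Fin d)) = (R / 4 * t) • direction v := by
      ext k; simp [hg, mul_assoc]
    rw [this, norm_smul, Real.norm_eq_abs, abs_mul, ht, abs_of_nonneg (by positivity), mul_one]
    exact mul_le_of_le_one_right (by positivity) (norm_direction_le v)
  rw [Fin.sum_univ_four]
  have h0 := key 1 (by simp) ν (fun k => firstWeights μ ν R k 0) (by simp [firstWeights])
  have h1 := key (-1) (by simp) ν (fun k => firstWeights μ ν R k 1) (by simp [firstWeights])
  have h2 := key 1 (by simp) μ (fun k => firstWeights μ ν R k 2) (by simp [firstWeights])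
  have h3 := key (-1) (by simp) μ (fun k => firstWeights μ ν R k 3) (by simp [firstWeights])
  linarith

lemma norm_outputWeights_le {t : ℝ} (ht : |t| ≤ 1) : ‖outputWeights t‖ ≤ 1 := by
  refine (l2_opNorm_le_sum_col _).trans ?_
  have : t ^ 2 ≤ 1 := (sq_le_one_iff_abs_le_one t).2 ht
  simp only [EuclideanSpace.norm_eq, Fin.sum_univ_four, Finset.univ_unique, Finset.sum_singleton]
  rw [Real.sqrt_le_one]
  simp [outputWeights]
  nlinarith [abs_nonneg t]

lemma norm_pairingWeights_le : ‖pairingWeights‖ ≤ 1 := by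
  refine (l2_opNorm_le_sum_col _).trans ?_
  simp only [EuclideanSpace.norm_eq, Fin.sum_univ_four, Fin.sum_univ_two]
  have h (x : ℝ) (hx : x ≤ 1 / 4) : √x ≤ 1 / 2 :=
    (Real.sqrt_le_sqrt hx).trans (by rw [Real.sqrt_le_left (by norm_num)]; norm_num)
  have h0 := h (1 / 16 + 1 / 16) (by norm_num)
  simp [pairingWeights] at h0 ⊢
  norm_num at h0 ⊢
  linarith

lemma norm_differenceWeights_le {t : ℝ} (ht : |t| ≤ 1) : ‖differenceWeights t‖ ≤ 1 := by
  refine (l2_opNorm_le_sum_col _).trans ?_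
  have : t ^ 2 ≤ 1 := (sq_le_one_iff_abs_le_one t).2 ht
  simp only [EuclideanSpace.norm_eq, Fin.sum_univ_two, Finset.univ_unique, Finset.sum_singleton]
  rw [Real.sqrt_le_one]
  simp [differenceWeights]
  nlinarith [abs_nonneg t]

end Norms

lemma twoLayer_feasible {d : ℕ} (μ ν : EuclideanSpace ℝ (Fin d)) {R t : ℝ} (hR : 0 ≤ R)
    (ht : |t| ≤ 1) : (twoLayer μ ν R t).Feasible R :=
  ⟨norm_firstWeights_le μ ν hR, norm_outputWeights_le ht⟩

lemma threeLayer_feasible {d : ℕ} (μ ν : EuclideanSpace ℝ (Fin d)) {R t : ℝ} (hR : 0 ≤ R)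
    (ht : |t| ≤ 1) : (threeLayer μ ν R t).Feasible R :=
  ⟨norm_firstWeights_le μ ν hR, norm_pairingWeights_le, norm_differenceWeights_le ht⟩

/-- The statistic `|⟨x, ν⟩| - |⟨x, μ⟩|` (with `μ`, `ν` normalized) computed by the networks. -/
noncomputable def axisContrast {d : ℕ} (μ ν x : EuclideanSpace ℝ (Fin d)) : ℝ :=
  |inner ℝ (direction ν) x| - |inner ℝ (direction μ) x|

lemma pairingWeights_mul_differenceWeights (t : ℝ) :
    pairingWeights * differenceWeights t = outputWeights t := by
  ext i j
  fin_cases i <;> fin_cases j <;>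
    simp [pairingWeights, differenceWeights, outputWeights, Matrix.mul_apply, Fin.sum_univ_two] <;>
    ring

lemma hidden_mul_outputWeights {n d : ℕ} (μ ν : EuclideanSpace ℝ (Fin d)) {R : ℝ} (hR : 0 ≤ R)
    (t : ℝ) (e : Graph n) (x : Features n d) (i : Fin n) :
    (relu (preactivation e 0 (Matrix.of fun i k => x i k) (firstWeights μ ν R) 0) *
      outputWeights t) i 0 = t * R / 32 * axisContrast μ ν (x i) := by
  have hin (c : ℝ) (v : EuclideanSpace ℝ (Fin d)) :
      ∑ k, x i k * (R / 4 * (c * v k)) = R / 4 * (c * inner ℝ v (x i)) := by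
    rw [PiLp.inner_apply, Finset.mul_sum, Finset.mul_sum]
    refine Finset.sum_congr rfl fun k _ => ?_
    simp; ring
  have h1 := hin 1
  have h2 := hin (-1)
  simp only [one_mul, neg_one_mul] at h1 h2
  have habs (a : ℝ) : max (R / 4 * a) 0 + max (R / 4 * -a) 0 = R / 4 * |a| := by
    rcases le_total 0 a with h | h
    · rw [abs_of_nonneg h, max_eq_left (by positivity), max_eq_right (by nlinarith), add_zero]
    · have : R / 4 * a ≤ 0 := mul_nonpos_of_nonneg_of_nonpos (by positivity) h
      rw [abs_of_nonpos h, max_eq_right this, zero_add, max_eq_left (by linarith)]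
  simp only [Matrix.mul_apply, Fin.sum_univ_four, relu, preactivation, firstWeights, outputWeights,
    Matrix.map_apply, Matrix.add_apply, pow_zero, Matrix.one_mul, Matrix.of_apply, Pi.zero_apply,
    add_zero, Matrix.cons_val, h1, h2, axisContrast]
  have e1 := habs (inner ℝ (direction ν) (x i))
  have e2 := habs (inner ℝ (direction μ) (x i))
  linear_combination t / 8 * e1 - t / 8 * e2

/-! ### The convolution matrix -/

section Convolution

variable {n : ℕ} (e : Graph n)

lemma convolution_apply (i j : Fin n) :
    convolution e i j = (degree e i)⁻¹ * adjacency e i j := by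
  simp [convolution, Matrix.diagonal_mul]

lemma adjacency_nonneg (i j : Fin n) : 0 ≤ adjacency e i j := by
  simp only [adjacency, Matrix.of_apply]; split_ifs <;> simp

lemma adjacency_le_one (i j : Fin n) : adjacency e i j ≤ 1 := by
  simp only [adjacency, Matrix.of_apply]; split_ifs <;> simp

lemma adjacency_sq (i j : Fin n) : adjacency e i j ^ 2 = adjacency e i j := by
  simp only [adjacency, Matrix.of_apply]; split_ifs <;> simp

lemma degree_nonneg (i : Fin n) : 0 ≤ degree e i :=
  Finset.sum_nonneg fun j _ => adjacency_nonneg e i j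

lemma convolution_nonneg (i j : Fin n) : 0 ≤ convolution e i j := by
  rw [convolution_apply]
  exact mul_nonneg (inv_nonneg.2 (degree_nonneg e i)) (adjacency_nonneg e i j)

lemma convolution_pow_nonneg (k : ℕ) (i j : Fin n) : 0 ≤ (convolution e ^ k) i j := by
  induction k generalizing i j with
  | zero => rw [pow_zero, Matrix.one_apply]; split_ifs <;> simp
  | succ k ih =>
    rw [pow_succ, Matrix.mul_apply]
    exact Finset.sum_nonneg fun l _ => mul_nonneg (ih i l) (convolution_nonneg e l j)

lemma sum_convolution_le_one (i : Fin n) : ∑ j, convolution e i j ≤ 1 := by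
  simp only [convolution_apply, ← Finset.mul_sum]
  exact inv_mul_le_one

lemma sum_convolution_sq_le_one (i : Fin n) : ∑ j, (convolution e ^ 2) i j ≤ 1 := by
  simp only [pow_two, Matrix.mul_apply]
  rw [Finset.sum_comm]
  simp only [← Finset.mul_sum]
  calc _ ≤ ∑ j, convolution e i j * 1 := by
        gcongr with j
        · exact convolution_nonneg e i j
        · exact sum_convolution_le_one e j
    _ ≤ 1 := by simpa using sum_convolution_le_one e i

end Convolution

lemma twoLayer_output {n d : ℕ} (μ ν : EuclideanSpace ℝ (Fin d)) {R : ℝ} (hR : 0 ≤ R) (t : ℝ)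
    (k : ℕ) (e : Graph n) (x : Features n d) (i : Fin n) :
    (twoLayer μ ν R t).output 0 k e (Matrix.of fun i k => x i k) i =
      Real.sigmoid (t * R / 32 * ∑ j, (convolution e ^ k) i j * axisContrast μ ν (x j)) := by
  simp only [TwoLayer.output, twoLayer]
  congr 1
  rw [preactivation]
  simp only [Matrix.add_apply, Matrix.of_apply, Pi.zero_apply, add_zero]
  rw [Matrix.mul_assoc, Matrix.mul_apply, Finset.mul_sum]
  refine Finset.sum_congr rfl fun j _ => ?_
  have := hidden_mul_outputWeights μ ν hR t e x j
  rw [this]; ring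

lemma threeLayer_output {n d : ℕ} (μ ν : EuclideanSpace ℝ (Fin d)) {R : ℝ} (hR : 0 ≤ R) (t : ℝ)
    (k₂ k₃ : ℕ) (e : Graph n) (x : Features n d) (i : Fin n) :
    (threeLayer μ ν R t).output 0 k₂ k₃ e (Matrix.of fun i k => x i k) i =
      Real.sigmoid
        (t * R / 32 * ∑ j, (convolution e ^ (k₂ + k₃)) i j * axisContrast μ ν (x j)) := by
  rw [← twoLayer_output μ ν hR]
  simp only [ThreeLayer.output, TwoLayer.output, twoLayer, threeLayer]
  congr 1
  set H := relu (preactivation e 0 (Matrix.of fun i k => x i k) (firstWeights μ ν R) 0) with hH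
  have hH0 (i j) : 0 ≤ H i j := by simp [hH, relu]
  have hpos : relu (preactivation e k₂ H pairingWeights 0) =
      convolution e ^ k₂ * H * pairingWeights := by
    ext a b
    simp only [relu, preactivation, Matrix.map_apply, Matrix.add_apply, Matrix.of_apply,
      Pi.zero_apply, add_zero]
    refine max_eq_left ?_
    simp only [Matrix.mul_apply]
    refine Finset.sum_nonneg fun c _ => mul_nonneg (Finset.sum_nonneg fun f _ =>
      mul_nonneg (convolution_pow_nonneg e _ _ _) (hH0 _ _)) ?_
    fin_cases c <;> fin_cases b <;> simp [pairingWeights]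
  rw [hpos]
  simp only [preactivation, Matrix.add_apply, Matrix.of_apply, Pi.zero_apply, add_zero]
  rw [← pairingWeights_mul_differenceWeights, add_comm k₂ k₃, pow_add]
  simp only [Matrix.mul_assoc]

/-! ### The loss of nearly constant outputs -/

/-- The sign `±1` of a class. -/
def classSign (b : Bool) : ℝ := if b then 1 else -1

@[simp] lemma classSign_true : classSign true = 1 := rfl

@[simp] lemma classSign_false : classSign false = -1 := by simp [classSign]

lemma classSign_mul_self (b : Bool) : classSign b * classSign b = 1 := by cases b <;> simp

lemma abs_classSign (b : Bool) : |classSign b| = 1 := by cases b <;> simp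

lemma crossEntropy_sigmoid {n : ℕ} (y : Fin n → Bool) (f : Fin n → ℝ) :
    crossEntropy y (fun i => Real.sigmoid (f i)) =
      (1 / (n : ℝ)) * ∑ i, Real.log (1 + Real.exp (-(classSign (y i) * f i))) := by
  rw [crossEntropy, neg_mul, ← mul_neg, ← Finset.sum_neg_distrib]
  congr 1
  refine Finset.sum_congr rfl fun i _ => ?_
  cases y i
  · have := Real.sigmoid_neg (f i)
    simp only [Bool.false_eq_true, if_false, zero_mul, zero_add, sub_zero, one_mul, ← this]
    simp [Real.sigmoid_def, Real.log_inv]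
  · simp [Real.sigmoid_def, Real.log_inv]

lemma classifies_and_lossIs {n : ℕ} (hn : 0 < n) (y : Fin n → Bool) (f : Fin n → ℝ) {E η : ℝ}
    (hE : 0 < E) (hη : η < 1) (hf : ∀ i, |f i - E * classSign (y i)| ≤ E * η) :
    Classifies y (fun i => Real.sigmoid (f i)) ∧
      LossIs y (fun i => Real.sigmoid (f i)) E η := by
  have hlow (i) : E * (1 - η) ≤ classSign (y i) * f i := by
    have := abs_le.1 (hf i)
    cases h : y i <;> simp [h] at this ⊢ <;> nlinarith
  have hup (i) : classSign (y i) * f i ≤ E * (1 + η) := by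
    have := abs_le.1 (hf i)
    cases h : y i <;> simp [h] at this ⊢ <;> nlinarith
  have hη0 : 0 ≤ η := by
    have := (abs_nonneg _).trans (hf ⟨0, hn⟩)
    exact nonneg_of_mul_nonneg_right this hE
  constructor
  · intro i
    have h2 : (1 / 2 : ℝ) = Real.sigmoid 0 := by norm_num [Real.sigmoid_zero]
    rw [h2, Real.sigmoid_le_iff]
    have := hlow i
    have h3 : 0 < E * (1 - η) := mul_pos hE (by linarith)
    cases h : y i <;> simp [h] at this ⊢ <;> linarith
  · have hn' : (0 : ℝ) < n := by exact_mod_cast hn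
    set L := crossEntropy y (fun i => Real.sigmoid (f i)) with hL
    rw [crossEntropy_sigmoid] at hL
    have hLup : L ≤ Real.exp (-(E * (1 - η))) := by
      have : ∑ i, Real.log (1 + Real.exp (-(classSign (y i) * f i))) ≤
          ∑ i : Fin n, Real.exp (-(E * (1 - η))) := by
        refine Finset.sum_le_sum fun i _ => ?_
        have h1 := Real.log_le_sub_one_of_pos
          (show 0 < 1 + Real.exp (-(classSign (y i) * f i)) by positivity)
        have h2 := Real.exp_le_exp.2 (neg_le_neg (hlow i))
        linarith
      rw [hL]
      calc _ ≤ (1 / (n : ℝ)) * ∑ i : Fin n, Real.exp (-(E * (1 - η))) := by gcongr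
        _ = _ := by simp; field_simp
    have hLlow : 1 / 2 * Real.exp (-(E * (1 + η))) ≤ L := by
      have : ∑ i : Fin n, 1 / 2 * Real.exp (-(E * (1 + η))) ≤
          ∑ i, Real.log (1 + Real.exp (-(classSign (y i) * f i))) := by
        refine Finset.sum_le_sum fun i _ => ?_
        set u := Real.exp (-(E * (1 + η))) with hu
        have hu0 : 0 < u := Real.exp_pos _
        have hu1 : u ≤ 1 := Real.exp_le_one_iff.2 (by nlinarith)
        have h2 : u ≤ Real.exp (-(classSign (y i) * f i)) :=
          Real.exp_le_exp.2 (neg_le_neg (hup i))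
        have h3 : Real.log (1 + u) ≤ Real.log (1 + Real.exp (-(classSign (y i) * f i))) :=
          Real.log_le_log (by positivity) (by linarith)
        have h4 := Real.one_sub_inv_le_log_of_pos (show 0 < 1 + u by positivity)
        have h5 : 1 / 2 * u ≤ 1 - (1 + u)⁻¹ := by
          rw [le_sub_iff_add_le, inv_eq_one_div, ← le_sub_iff_add_le', div_le_iff₀ (by positivity)]
          nlinarith
        linarith
      rw [hL]
      calc _ = (1 / (n : ℝ)) * ∑ i : Fin n, 1 / 2 * Real.exp (-(E * (1 + η))) := by
            simp; field_simp
        _ ≤ _ := by gcongr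
    have hLpos : 0 < L := lt_of_lt_of_le (by positivity) hLlow
    by_cases hcase : Real.exp (-(E * (1 + η))) ≤ L
    · refine ⟨1, by norm_num, -Real.log L / E - 1, ?_, ?_⟩
      · have h1 : -(E * (1 + η)) ≤ Real.log L := (Real.le_log_iff_exp_le hLpos).2 hcase
        have h2 : Real.log L ≤ -(E * (1 - η)) := (Real.log_le_iff_le_exp hLpos).2 hLup
        rw [abs_le, le_sub_iff_add_le, sub_le_iff_le_add, le_div_iff₀ hE, div_le_iff₀ hE]
        constructor <;> linarith
      · rw [one_mul]
        have : -(E * (1 + (-Real.log L / E - 1))) = Real.log L := by field_simp; ring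
        rw [this, Real.exp_log hLpos]
    · push Not at hcase
      refine ⟨L / Real.exp (-(E * (1 + η))), ⟨?_, ?_⟩, η, (abs_of_nonneg hη0).le, ?_⟩
      · rw [le_div_iff₀ (Real.exp_pos _)]; exact hLlow
      · rw [div_le_one (Real.exp_pos _)]; exact hcase.le
      · rw [div_mul_cancel₀ _ (Real.exp_pos _).ne']

lemma succeed_of_close {n d : ℕ} (hn : 0 < n) (μ ν : EuclideanSpace ℝ (Fin d)) {R : ℝ}
    (hR : 0 ≤ R) (t : ℝ) (k : ℕ) {E η : ℝ} (hE : 0 < E) (hη : η < 1) (S : Sample n d)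
    (hf : ∀ i, |t * R / 32 * ∑ j, (convolution S.2.1 ^ k) i j * axisContrast μ ν (S.2.2 j) -
      E * classSign (S.1 i).1| ≤ E * η) :
    Succeed (twoLayer μ ν R t) (threeLayer μ ν R t) k E η S := by
  have h := classifies_and_lossIs hn S.classes _ hE hη hf
  have h2 : (twoLayer μ ν R t).output 0 k S.graph S.data = fun i => Real.sigmoid
      (t * R / 32 * ∑ j, (convolution S.2.1 ^ k) i j * axisContrast μ ν (S.2.2 j)) :=
    funext fun i => twoLayer_output μ ν hR t k S.2.1 S.2.2 i
  refine ⟨by rw [h2]; exact h, fun k₂ k₃ hk => ?_⟩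
  have h3 : (threeLayer μ ν R t).output 0 k₂ k₃ S.graph S.data = fun i => Real.sigmoid
      (t * R / 32 * ∑ j, (convolution S.2.1 ^ k) i j * axisContrast μ ν (S.2.2 j)) :=
    funext fun i => hk ▸ threeLayer_output μ ν hR t k₂ k₃ S.2.1 S.2.2 i
  rw [h3]; exact h

/-! ### Concentration of the labels -/

lemma sum_labels_exp {n : ℕ} (t : ℝ) :
    ∑ l : Labels n, Real.exp (t * ∑ j, classSign (l j).1) ≤
      4 ^ n * Real.exp (n * (t ^ 2 / 2)) := by
  have h1 : ∑ l : Labels n, Real.exp (t * ∑ j, classSign (l j).1) =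
      ∏ _j : Fin n, ∑ b : Bool × Bool, Real.exp (t * classSign b.1) := by
    rw [Finset.prod_univ_sum, Fintype.piFinset_univ]
    refine Finset.sum_congr rfl fun l _ => ?_
    rw [Finset.mul_sum, Real.exp_sum]
  have h2 : ∑ b : Bool × Bool, Real.exp (t * classSign b.1) = 4 * Real.cosh t := by
    rw [Fintype.sum_prod_type]
    simp [Real.cosh_eq]
    ring
  rw [h1, h2, Finset.prod_const, Finset.card_univ, Fintype.card_fin, mul_pow, Real.exp_nat_mul]
  gcongr
  exact Real.cosh_le_exp_half_sq t

lemma card_labels_le {n : ℕ} (hn : 0 < n) {ℓ : ℝ} (hℓ : 0 ≤ ℓ) :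
    ((Finset.univ.filter fun l : Labels n =>
      √(2 * n * ℓ) ≤ |∑ j, classSign (l j).1|).card : ℝ) ≤ 4 ^ n * (2 * Real.exp (-ℓ)) := by
  have hn' : (0 : ℝ) < n := by exact_mod_cast hn
  set a := √(2 * n * ℓ) with ha
  have ha2 : a ^ 2 = 2 * n * ℓ := Real.sq_sqrt (by positivity)
  set t := a / n with ht
  have ht0 : 0 ≤ t := by positivity
  rw [Finset.card_filter, Nat.cast_sum]
  have hle (l : Labels n) : ((if a ≤ |∑ j, classSign (l j).1| then 1 else 0 : ℕ) : ℝ) ≤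
      Real.exp (-(t * a)) * Real.exp (t * ∑ j, classSign (l j).1) +
      Real.exp (-(t * a)) * Real.exp (-t * ∑ j, classSign (l j).1) := by
    rw [← Real.exp_add, ← Real.exp_add]
    split_ifs with h
    · push_cast
      rcases le_abs.1 h with h | h
      · have := Real.one_le_exp (x := -(t * a) + t * ∑ j, classSign (l j).1) (by nlinarith)
        have := Real.exp_pos (-(t * a) + -t * ∑ j, classSign (l j).1)
        linarith
      · have := Real.one_le_exp (x := -(t * a) + -t * ∑ j, classSign (l j).1) (by nlinarith)
        have := Real.exp_pos (-(t * a) + t * ∑ j, classSign (l j).1)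
        linarith
    · push_cast; positivity
  refine (Finset.sum_le_sum fun l _ => hle l).trans ?_
  rw [Finset.sum_add_distrib, ← Finset.mul_sum, ← Finset.mul_sum]
  have e1 := sum_labels_exp (n := n) t
  have e2 := sum_labels_exp (n := n) (-t)
  rw [neg_sq] at e2
  have e3 : Real.exp (-(t * a)) * (4 ^ n * Real.exp (n * (t ^ 2 / 2))) =
      4 ^ n * Real.exp (-ℓ) := by
    rw [mul_left_comm, ← Real.exp_add]
    congr 2
    rw [ht]; field_simp; rw [ha2]; ring
  have := mul_le_mul_of_nonneg_left e1 (Real.exp_pos (-(t * a))).le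
  have := mul_le_mul_of_nonneg_left e2 (Real.exp_pos (-(t * a))).le
  linarith

/-! ### Concentration of the graph -/

instance {n : ℕ} (p q s : unitInterval) (l : Labels n) :
    IsProbabilityMeasure (graphLaw p q s l) := by
  unfold graphLaw; infer_instance

lemma exp_mul_bernoulli_le {c x : ℝ} (hc : |c| ≤ 1) (hx : 0 ≤ x) :
    x * Real.exp (c * (1 - x)) + (1 - x) * Real.exp (c * (0 - x)) ≤ Real.exp (c ^ 2 * x) := by
  have h1 : x * Real.exp (c * (1 - x)) + (1 - x) * Real.exp (c * (0 - x)) =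
      Real.exp (-(c * x)) * (x * (Real.exp c - 1) + 1) := by
    rw [show c * (1 - x) = -(c * x) + c by ring, Real.exp_add,
      show c * (0 - x) = -(c * x) by ring]
    ring
  have h2 : Real.exp c - 1 ≤ c + c ^ 2 := by
    have := (abs_le.1 (Real.abs_exp_sub_one_sub_id_le hc)).2
    linarith
  have h3 : x * (Real.exp c - 1) + 1 ≤ Real.exp (x * (c + c ^ 2)) :=
    (by gcongr : x * (Real.exp c - 1) + 1 ≤ x * (c + c ^ 2) + 1).trans (Real.add_one_le_exp _)
  rw [h1]
  calc _ ≤ Real.exp (-(c * x)) * Real.exp (x * (c + c ^ 2)) := by gcongr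
    _ = _ := by rw [← Real.exp_add]; congr 1; ring

/-- The probability of an edge between `i` and `j`, as a real number. -/
noncomputable def linkProb {n : ℕ} (p q s : unitInterval) (l : Labels n) (i j : Fin n) : ℝ :=
  edgeProb p q s l s(i, j)

lemma linkProb_nonneg {n : ℕ} (p q s : unitInterval) (l : Labels n) (i j : Fin n) :
    0 ≤ linkProb p q s l i j := (edgeProb p q s l s(i, j)).2.1

lemma linkProb_of_ne {n : ℕ} (p q s : unitInterval) (l : Labels n) {i j : Fin n} (h : i ≠ j) :
    linkProb p q s l i j =
      ((p : ℝ) + q) / 2 + classSign (l i).1 * classSign (l j).1 * (((p : ℝ) - q) / 2) := by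
  simp only [linkProb, edgeProb, Sym2.lift_mk, if_neg h]
  cases (l i).1 <;> cases (l j).1 <;> simp <;> ring

lemma linkProb_le {n : ℕ} (p q s : unitInterval) (l : Labels n) {i j : Fin n} (h : i ≠ j) :
    linkProb p q s l i j ≤ (p : ℝ) + q := by
  have := p.2.1
  have := q.2.1
  simp only [linkProb, edgeProb, Sym2.lift_mk, if_neg h]
  split_ifs <;> linarith

lemma sum_linkProb_le {n : ℕ} (p q s : unitInterval) (l : Labels n) (i : Fin n) :
    ∑ j ∈ Finset.univ.erase i, linkProb p q s l i j ≤ n * ((p : ℝ) + q) := by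
  have hp := p.2.1
  have hq := q.2.1
  calc _ ≤ ∑ j ∈ Finset.univ.erase i, ((p : ℝ) + q) :=
        Finset.sum_le_sum fun j hj => linkProb_le p q s l (Finset.ne_of_mem_erase hj).symm
    _ ≤ ∑ j : Fin n, ((p : ℝ) + q) :=
        Finset.sum_le_sum_of_subset_of_nonneg (Finset.erase_subset _ _) fun _ _ _ => by linarith
    _ = _ := by simp [mul_add]

lemma iIndepFun_edge {n : ℕ} (p q s : unitInterval) (l : Labels n)
    (F : Sym2 (Fin n) → Bool → ℝ) :
    iIndepFun (fun a (e : Graph n) => F a (e a)) (graphLaw p q s l) :=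
  iIndepFun_pi (X := F) fun _ => (measurable_of_finite _).aemeasurable

lemma integral_edge {n : ℕ} (p q s : unitInterval) (l : Labels n) (a : Sym2 (Fin n))
    (f : Bool → ℝ) :
    ∫ e, f (e a) ∂(graphLaw p q s l) =
      edgeProb p q s l a * f true + (1 - edgeProb p q s l a) * f false := by
  rw [graphLaw, integral_comp_eval (μ := fun a => bernoulliMeasure true false (edgeProb p q s l a))
    (measurable_of_finite f).aestronglyMeasurable, integral_bernoulliMeasure]
  simp

lemma graphLaw_sum_ge_le {n : ℕ} (p q s : unitInterval) (l : Labels n) (i : Fin n)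
    {w : Fin n → ℝ} (hw : ∀ j, |w j| ≤ 1) {V ℓ : ℝ} (hV : 0 < V) (hℓ : 0 ≤ ℓ) (hℓV : ℓ ≤ V)
    (hsum : ∑ j ∈ Finset.univ.erase i, linkProb p q s l i j ≤ V) :
    (graphLaw p q s l).real {e | 2 * √(V * ℓ) ≤
      ∑ j ∈ Finset.univ.erase i, w j * (adjacency e i j - linkProb p q s l i j)} ≤
      Real.exp (-ℓ) := by
  set r := √(ℓ / V) with hr
  have hr0 : 0 ≤ r := Real.sqrt_nonneg _
  have hr1 : r ≤ 1 := Real.sqrt_le_one.2 ((div_le_one hV).2 hℓV)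
  have hr2 : r ^ 2 * V = ℓ := by rw [hr, Real.sq_sqrt (by positivity)]; field_simp
  have hrV : √(V * ℓ) = r * V := by
    rw [← hr2, show V * (r ^ 2 * V) = (r * V) ^ 2 by ring, Real.sqrt_sq (by positivity)]
  set X : Fin n → Graph n → ℝ := fun j e => w j * (adjacency e i j - linkProb p q s l i j)
    with hX
  have hXm (j) : Measurable (X j) := measurable_of_finite _
  have hind : iIndepFun X (graphLaw p q s l) := by
    have hinj : Function.Injective fun j : Fin n => s(i, j) := fun a b h => Sym2.congr_right.1 h
    have h := (iIndepFun_edge p q s l fun a b => (if b then (1 : ℝ) else 0)).precomp hinj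
    exact h.comp (fun j x => w j * (x - linkProb p q s l i j)) fun j => by fun_prop
  have hmgf (j) : mgf (X j) (graphLaw p q s l) r ≤ Real.exp (r ^ 2 * linkProb p q s l i j) := by
    have h := integral_edge p q s l s(i, j)
      fun b => Real.exp (r * (w j * ((if b then (1 : ℝ) else 0) - linkProb p q s l i j)))
    have hc : |r * w j| ≤ 1 := by
      rw [abs_mul, abs_of_nonneg hr0]
      exact mul_le_one₀ hr1 (abs_nonneg _) (hw j)
    have hb := exp_mul_bernoulli_le hc (linkProb_nonneg p q s l i j)
    have h2 : mgf (X j) (graphLaw p q s l) r = linkProb p q s l i j *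
        Real.exp (r * w j * (1 - linkProb p q s l i j)) + (1 - linkProb p q s l i j) *
        Real.exp (r * w j * (0 - linkProb p q s l i j)) := by
      simp only [mgf, hX, adjacency, Matrix.of_apply]
      rw [h]
      simp only [linkProb, if_true, Bool.false_eq_true, if_false, mul_assoc]
    rw [h2]
    refine hb.trans (Real.exp_le_exp.2 ?_)
    refine mul_le_mul_of_nonneg_right ?_ (linkProb_nonneg p q s l i j)
    rw [mul_pow]
    exact mul_le_of_le_one_right (sq_nonneg r) ((sq_le_one_iff_abs_le_one _).2 (hw j))
  have hch := measure_ge_le_exp_mul_mgf (μ := graphLaw p q s l)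
    (X := ∑ j ∈ Finset.univ.erase i, X j) (2 * √(V * ℓ)) hr0 Integrable.of_finite
  rw [hind.mgf_sum hXm] at hch
  simp only [Finset.sum_apply, hX] at hch
  refine hch.trans ?_
  calc _ ≤ Real.exp (-r * (2 * √(V * ℓ))) *
        ∏ j ∈ Finset.univ.erase i, Real.exp (r ^ 2 * linkProb p q s l i j) := by
        gcongr with j
        · exact fun j _ => mgf_nonneg
        · exact hmgf j
    _ ≤ Real.exp (-r * (2 * √(V * ℓ))) * Real.exp (r ^ 2 * V) := by
        rw [← Real.exp_sum, ← Finset.mul_sum]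
        gcongr
    _ = Real.exp (-ℓ) := by
        rw [← Real.exp_add, hrV]
        congr 1
        linear_combination -hr2

lemma graphLaw_abs_sum_ge_le {n : ℕ} (p q s : unitInterval) (l : Labels n) (i : Fin n)
    {w : Fin n → ℝ} (hw : ∀ j, |w j| ≤ 1) {V ℓ : ℝ} (hV : 0 < V) (hℓ : 0 ≤ ℓ) (hℓV : ℓ ≤ V)
    (hsum : ∑ j ∈ Finset.univ.erase i, linkProb p q s l i j ≤ V) :
    (graphLaw p q s l).real {e | 2 * √(V * ℓ) ≤
      |∑ j ∈ Finset.univ.erase i, w j * (adjacency e i j - linkProb p q s l i j)|} ≤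
      2 * Real.exp (-ℓ) := by
  have h1 := graphLaw_sum_ge_le p q s l i hw hV hℓ hℓV hsum
  have h2 := graphLaw_sum_ge_le p q s l i (w := fun j => -w j) (by simpa using hw) hV hℓ hℓV hsum
  simp only [neg_mul, Finset.sum_neg_distrib] at h2
  rw [two_mul (Real.exp (-ℓ))]
  refine le_trans ?_ (add_le_add h1 h2)
  refine le_trans (measureReal_mono ?_) (measureReal_union_le _ _)
  intro e he
  simpa only [Set.mem_union, Set.mem_ofPred_eq, le_abs] using he

/-! ### Common neighbours -/

/-- The number of common neighbours of `i` and `j` other than `i` and `j`. -/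
noncomputable def codegree {n : ℕ} (e : Graph n) (i j : Fin n) : ℝ :=
  ∑ k ∈ (Finset.univ.erase i).erase j, adjacency e i k * adjacency e k j

lemma integral_prod_edges {n : ℕ} (p q s : unitInterval) (l : Labels n)
    (T : Finset (Sym2 (Fin n))) :
    ∫ e : Graph n, ∏ a ∈ T, (if e a then (1 : ℝ) else 0) ∂(graphLaw p q s l) =
      ∏ a ∈ T, (edgeProb p q s l a : ℝ) := by
  have h := integral_fintype_prod_eq_prod (ι := Sym2 (Fin n)) (𝕜 := ℝ)
    (μ := fun a => bernoulliMeasure true false (edgeProb p q s l a))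
    (f := fun a b => if a ∈ T then (if b then (1 : ℝ) else 0) else 1)
  simp only [Finset.prod_ite_mem, Finset.univ_inter] at h
  rw [graphLaw, h]
  rw [← Finset.prod_subset (Finset.subset_univ T)]
  · refine Finset.prod_congr rfl fun a ha => ?_
    simp only [if_pos ha]
    rw [integral_bernoulliMeasure]
    simp
  · intro a _ ha
    simp [if_neg ha]

lemma integral_exp_codegree_le {n : ℕ} (p q s : unitInterval) (l : Labels n) {i j : Fin n}
    (hij : i ≠ j) :
    ∫ e : Graph n, Real.exp (codegree e i j) ∂(graphLaw p q s l) ≤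
      Real.exp ((Real.exp 1 - 1) * (n * ((p : ℝ) + q) ^ 2)) := by
  set T := (Finset.univ.erase i).erase j with hT
  set c := Real.exp 1 - 1 with hc
  have hc0 : 0 ≤ c := by have := Real.add_one_le_exp (1 : ℝ); linarith
  have hexp (e : Graph n) : Real.exp (codegree e i j) =
      ∑ U ∈ T.powerset, c ^ U.card *
        ∏ a ∈ U.image (fun k => s(i, k)) ∪ U.image (fun k => s(k, j)),
          (if e a then (1 : ℝ) else 0) := by
    rw [codegree, Real.exp_sum]
    have h1 (k) : Real.exp (adjacency e i k * adjacency e k j) =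
        1 + c * (adjacency e i k * adjacency e k j) := by
      simp only [adjacency, Matrix.of_apply]
      split_ifs <;> simp [hc]
    simp only [h1]
    rw [Finset.prod_one_add]
    refine Finset.sum_congr rfl fun U hU => ?_
    have hU' : ∀ k ∈ U, k ≠ i ∧ k ≠ j := fun k hk => by
      have := Finset.mem_powerset.1 hU hk
      rw [hT, Finset.mem_erase, Finset.mem_erase] at this
      exact ⟨this.2.1, this.1⟩
    rw [Finset.prod_mul_distrib, Finset.prod_const, Finset.prod_mul_distrib,
      Finset.prod_union, Finset.prod_image, Finset.prod_image]
    · rfl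
    · intro a _ b _ h; exact Sym2.congr_left.1 h
    · intro a _ b _ h; exact Sym2.congr_right.1 h
    · rw [Finset.disjoint_left]
      rintro a ha hb
      obtain ⟨k, hk, rfl⟩ := Finset.mem_image.1 ha
      obtain ⟨m, hm, h⟩ := Finset.mem_image.1 hb
      have := hU' k hk
      have := hU' m hm
      rw [Sym2.eq_iff] at h
      grind
  simp only [hexp]
  rw [integral_finsetSum _ fun _ _ => Integrable.of_finite]
  simp only [integral_const_mul, integral_prod_edges]
  have hle : ∀ U ∈ T.powerset, c ^ U.card *
      ∏ a ∈ U.image (fun k => s(i, k)) ∪ U.image (fun k => s(k, j)), (edgeProb p q s l a : ℝ) ≤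
      ∏ k ∈ U, c * ((p : ℝ) + q) ^ 2 := by
    intro U hU
    have hU' : ∀ k ∈ U, k ≠ i ∧ k ≠ j := fun k hk => by
      have := Finset.mem_powerset.1 hU hk
      rw [hT, Finset.mem_erase, Finset.mem_erase] at this
      exact ⟨this.2.1, this.1⟩
    rw [Finset.prod_mul_distrib, Finset.prod_const, Finset.prod_union, Finset.prod_image,
      Finset.prod_image, ← Finset.prod_mul_distrib]
    · gcongr with k hk
      · exact fun k _ => mul_nonneg (linkProb_nonneg p q s l i k) (linkProb_nonneg p q s l k j)
      rw [pow_two]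
      exact mul_le_mul (linkProb_le p q s l (hU' k hk).1.symm) (linkProb_le p q s l (hU' k hk).2)
        (linkProb_nonneg p q s l k j) (add_nonneg p.2.1 q.2.1)
    · intro a _ b _ h; exact Sym2.congr_left.1 h
    · intro a _ b _ h; exact Sym2.congr_right.1 h
    · rw [Finset.disjoint_left]
      rintro a ha hb
      obtain ⟨k, hk, rfl⟩ := Finset.mem_image.1 ha
      obtain ⟨m, hm, h⟩ := Finset.mem_image.1 hb
      have := hU' k hk
      have := hU' m hm
      rw [Sym2.eq_iff] at h
      grind
  refine (Finset.sum_le_sum hle).trans ?_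
  rw [← Finset.prod_one_add, Finset.prod_const]
  calc _ ≤ Real.exp (c * ((p : ℝ) + q) ^ 2) ^ T.card := by
        gcongr
        rw [add_comm]; exact Real.add_one_le_exp _
    _ ≤ Real.exp (c * ((p : ℝ) + q) ^ 2) ^ n := by
        refine pow_le_pow_right₀ (Real.one_le_exp (by positivity)) ?_
        simpa using Finset.card_le_univ T
    _ = _ := by rw [← Real.exp_nat_mul]; congr 1; ring

lemma graphLaw_codegree_ge_le {n : ℕ} (p q s : unitInterval) (l : Labels n) {i j : Fin n}
    (hij : i ≠ j) {ℓ : ℝ} (hℓ : ℓ ≤ n * ((p : ℝ) + q) ^ 2) :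
    (graphLaw p q s l).real {e | 3 * (n * ((p : ℝ) + q) ^ 2) ≤ codegree e i j} ≤
      Real.exp (-ℓ) := by
  have hch := measure_ge_le_exp_mul_mgf (μ := graphLaw p q s l)
    (X := fun e => codegree e i j) (t := 1) (3 * (n * ((p : ℝ) + q) ^ 2)) zero_le_one
    Integrable.of_finite
  refine hch.trans ?_
  have h := integral_exp_codegree_le p q s l hij
  simp only [mgf, one_mul]
  have he : Real.exp 1 < 3 := Real.exp_one_lt_three
  calc _ ≤ Real.exp (-1 * (3 * (n * ((p : ℝ) + q) ^ 2))) *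
        Real.exp ((Real.exp 1 - 1) * (n * ((p : ℝ) + q) ^ 2)) := by gcongr
    _ = Real.exp ((Real.exp 1 - 4) * (n * ((p : ℝ) + q) ^ 2)) := by
        rw [← Real.exp_add]; congr 1; ring
    _ ≤ _ := by
        refine Real.exp_le_exp.2 ?_
        have : 0 ≤ n * ((p : ℝ) + q) ^ 2 := by positivity
        nlinarith

/-! ### Convolutions on typical graphs -/

section Typical

variable {n : ℕ} {p q s : unitInterval} {l : Labels n} {e : Graph n}

lemma sum_erase_linkProb (i : Fin n) :
    ∑ j ∈ Finset.univ.erase i, linkProb p q s l i j =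
      (n - 1) * (((p : ℝ) + q) / 2) + classSign (l i).1 * (((p : ℝ) - q) / 2) *
        (∑ j, classSign (l j).1 - classSign (l i).1) := by
  rw [Finset.sum_congr rfl fun j hj => linkProb_of_ne p q s l (Finset.ne_of_mem_erase hj).symm,
    Finset.sum_add_distrib, Finset.sum_const, Finset.card_erase_of_mem (Finset.mem_univ i),
    ← Finset.sum_erase_eq_sub (Finset.mem_univ i), Finset.mul_sum]
  congr 1
  · have : 1 ≤ n := Nat.one_le_iff_ne_zero.2 (by rintro rfl; exact i.elim0)
    simp [Nat.cast_sub this]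
  · exact Finset.sum_congr rfl fun j _ => by ring

lemma sum_erase_linkProb_mul (i : Fin n) :
    ∑ j ∈ Finset.univ.erase i, classSign (l j).1 * linkProb p q s l i j =
      classSign (l i).1 * ((n - 1) * (((p : ℝ) - q) / 2)) + ((p : ℝ) + q) / 2 *
        (∑ j, classSign (l j).1 - classSign (l i).1) := by
  have h : ∀ j ∈ Finset.univ.erase i, classSign (l j).1 * linkProb p q s l i j =
      classSign (l i).1 * (((p : ℝ) - q) / 2) + ((p : ℝ) + q) / 2 * classSign (l j).1 := by
    intro j hj
    rw [linkProb_of_ne p q s l (Finset.ne_of_mem_erase hj).symm]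
    linear_combination classSign (l i).1 * (((p : ℝ) - q) / 2) * classSign_mul_self (l j).1
  rw [Finset.sum_congr rfl h,
    Finset.sum_add_distrib, Finset.sum_const, Finset.card_erase_of_mem (Finset.mem_univ i),
    ← Finset.sum_erase_eq_sub (Finset.mem_univ i), Finset.mul_sum]
  congr 1
  have : 1 ≤ n := Nat.one_le_iff_ne_zero.2 (by rintro rfl; exact i.elim0)
  simp [Nat.cast_sub this]
  ring

/-- The degrees and the signed degrees of a graph deviate from their means by at most
`2 √(n (p + q) ℓ)`. -/
def DegreesConcentrate (p q s : unitInterval) (l : Labels n) (e : Graph n) (ℓ : ℝ) : Prop :=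
  ∀ i, |∑ j ∈ Finset.univ.erase i, 1 * (adjacency e i j - linkProb p q s l i j)| ≤
      2 * √(n * ((p : ℝ) + q) * ℓ) ∧
    |∑ j ∈ Finset.univ.erase i, classSign (l j).1 * (adjacency e i j - linkProb p q s l i j)| ≤
      2 * √(n * ((p : ℝ) + q) * ℓ)

lemma mul_sqrt_le_sqrt {x π : ℝ} (hx : |x| ≤ π) (hπ : π ≤ 2) {m : ℕ} {ℓ : ℝ} (hℓ : 0 ≤ ℓ) :
    |x / 2| * √(2 * m * ℓ) ≤ √(m * π * ℓ) := by
  have hπ0 : 0 ≤ π := (abs_nonneg x).trans hx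
  refine Real.le_sqrt_of_sq_le ?_
  rw [mul_pow, Real.sq_sqrt (by positivity), sq_abs]
  have h1 : x ^ 2 ≤ π ^ 2 := sq_le_sq.2 (by rwa [abs_of_nonneg hπ0])
  have h2 : x ^ 2 / 2 ≤ π := by nlinarith
  have h3 : 0 ≤ (m : ℝ) * ℓ := by positivity
  nlinarith [mul_le_mul_of_nonneg_right h2 h3]

variable {ℓ : ℝ}

lemma abs_degree_sub_le (hℓ : 0 ≤ ℓ) (hV : 1 ≤ n * ((p : ℝ) + q) * ℓ)
    (hl : |∑ j, classSign (l j).1| ≤ √(2 * n * ℓ)) (he : DegreesConcentrate p q s l e ℓ)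
    (i : Fin n) :
    |degree e i - n * ((p : ℝ) + q) / 2| ≤ 6 * √(n * ((p : ℝ) + q) * ℓ) := by
  have hp := p.2
  have hq := q.2
  obtain ⟨hp0, hp1⟩ := hp
  obtain ⟨hq0, hq1⟩ := hq
  have h1 := (he i).1
  simp only [one_mul, Finset.sum_sub_distrib, sum_erase_linkProb] at h1
  have hd : degree e i = adjacency e i i + ∑ j ∈ Finset.univ.erase i, adjacency e i j :=
    (Finset.add_sum_erase _ _ (Finset.mem_univ i)).symm
  have hroot : 1 ≤ √(n * ((p : ℝ) + q) * ℓ) := Real.one_le_sqrt.2 hV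
  have hS : |classSign (l i).1 * (((p : ℝ) - q) / 2) * ∑ j, classSign (l j).1| ≤
      √(n * ((p : ℝ) + q) * ℓ) := by
    rw [abs_mul, abs_mul, abs_classSign, one_mul]
    refine (mul_le_mul_of_nonneg_left hl (abs_nonneg _)).trans (mul_sqrt_le_sqrt ?_ ?_ hℓ)
    · rw [abs_le]; constructor <;> linarith
    · linarith
  have ha0 := adjacency_nonneg e i i
  have ha1 := adjacency_le_one e i i
  have hss := classSign_mul_self (l i).1
  rw [abs_le] at h1 hS ⊢
  have hexp : classSign (l i).1 * (((p : ℝ) - q) / 2) *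
      (∑ j, classSign (l j).1 - classSign (l i).1) =
      classSign (l i).1 * (((p : ℝ) - q) / 2) * ∑ j, classSign (l j).1 - ((p : ℝ) - q) / 2 := by
    linear_combination -(((p : ℝ) - q) / 2) * hss
  rw [hexp] at h1
  constructor <;> linarith

lemma abs_signed_degree_sub_le (hℓ : 0 ≤ ℓ) (hV : 1 ≤ n * ((p : ℝ) + q) * ℓ)
    (hl : |∑ j, classSign (l j).1| ≤ √(2 * n * ℓ)) (he : DegreesConcentrate p q s l e ℓ)
    (i : Fin n) :
    |∑ j, adjacency e i j * classSign (l j).1 - n * ((p : ℝ) - q) / 2 * classSign (l i).1| ≤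
      6 * √(n * ((p : ℝ) + q) * ℓ) := by
  obtain ⟨hp0, hp1⟩ := p.2
  obtain ⟨hq0, hq1⟩ := q.2
  have h1 := (he i).2
  simp only [mul_sub, Finset.sum_sub_distrib, sum_erase_linkProb_mul] at h1
  have hd : ∑ j, adjacency e i j * classSign (l j).1 = adjacency e i i * classSign (l i).1 +
      ∑ j ∈ Finset.univ.erase i, classSign (l j).1 * adjacency e i j := by
    rw [← Finset.add_sum_erase _ _ (Finset.mem_univ i)]
    congr 1
    exact Finset.sum_congr rfl fun j _ => mul_comm _ _
  have hroot : 1 ≤ √(n * ((p : ℝ) + q) * ℓ) := Real.one_le_sqrt.2 hV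
  have hS : |((p : ℝ) + q) / 2 * ∑ j, classSign (l j).1| ≤
      √(n * ((p : ℝ) + q) * ℓ) := by
    rw [abs_mul]
    refine (mul_le_mul_of_nonneg_left hl (abs_nonneg _)).trans (mul_sqrt_le_sqrt ?_ ?_ hℓ)
    · rw [abs_le]; constructor <;> linarith
    · linarith
  have ha0 := adjacency_nonneg e i i
  have ha1 := adjacency_le_one e i i
  have hb : |(adjacency e i i - ((p : ℝ) - q) / 2 - ((p : ℝ) + q) / 2) * classSign (l i).1| ≤ 2 := by
    rw [abs_mul, abs_classSign, mul_one, abs_le]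
    constructor <;> linarith
  rw [abs_le] at h1 hS hb ⊢
  rw [hd]
  constructor <;> linarith

lemma quarter_le_degree (hℓ : 0 ≤ ℓ) (hV : 1 ≤ n * ((p : ℝ) + q) * ℓ)
    (hVℓ : 576 * ℓ ≤ n * ((p : ℝ) + q))
    (hl : |∑ j, classSign (l j).1| ≤ √(2 * n * ℓ)) (he : DegreesConcentrate p q s l e ℓ)
    (i : Fin n) : n * ((p : ℝ) + q) / 4 ≤ degree e i := by
  have h := (abs_le.1 (abs_degree_sub_le hℓ hV hl he i)).1
  set V := n * ((p : ℝ) + q) with hVdef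
  have hV0 : 0 ≤ V := mul_nonneg n.cast_nonneg (add_nonneg p.2.1 q.2.1)
  have : √(V * ℓ) ≤ V / 24 := by
    rw [Real.sqrt_le_left (by positivity)]
    nlinarith
  linarith

/-- The contrast `(p - q) / (p + q)` between the edge probabilities. -/
noncomputable def edgeContrast (p q : unitInterval) : ℝ := ((p : ℝ) - q) / (p + q)

lemma abs_edgeContrast_le_one (p q : unitInterval) : |edgeContrast p q| ≤ 1 := by
  have hp := p.2.1
  have hq := q.2.1
  rw [edgeContrast, abs_div, abs_of_nonneg (add_nonneg hp hq)]
  refine div_le_one_of_le₀ ?_ (add_nonneg hp hq)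
  rw [abs_le]
  constructor <;> linarith

lemma abs_convolution_classSign_sub_le (hℓ : 0 ≤ ℓ) (hV : 1 ≤ n * ((p : ℝ) + q) * ℓ)
    (hVℓ : 576 * ℓ ≤ n * ((p : ℝ) + q))
    (hl : |∑ j, classSign (l j).1| ≤ √(2 * n * ℓ)) (he : DegreesConcentrate p q s l e ℓ)
    (i : Fin n) :
    |∑ j, convolution e i j * classSign (l j).1 - edgeContrast p q * classSign (l i).1| ≤
      48 * √(ℓ / (n * ((p : ℝ) + q))) := by
  have hdeg := quarter_le_degree hℓ hV hVℓ hl he i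
  have h1 := abs_degree_sub_le hℓ hV hl he i
  have h2 := abs_signed_degree_sub_le hℓ hV hl he i
  have hπ0 : 0 ≤ (p : ℝ) + q := add_nonneg p.2.1 q.2.1
  have hV0 : 0 < n * ((p : ℝ) + q) := by
    refine (mul_nonneg n.cast_nonneg hπ0).lt_of_ne' fun h => ?_
    rw [h, zero_mul] at hV
    linarith
  have hπ : 0 < (p : ℝ) + q := hπ0.lt_of_ne' fun h => by simp [h] at hV0
  have hΓ : edgeContrast p q * (n * ((p : ℝ) + q) / 2) = n * ((p : ℝ) - q) / 2 := by
    rw [edgeContrast]; field_simp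
  have hΓ1 := abs_edgeContrast_le_one p q
  set V := n * ((p : ℝ) + q) with hVdef
  have hroot : √(V * ℓ) = V * √(ℓ / V) := by
    rw [show V * ℓ = V ^ 2 * (ℓ / V) by field_simp, Real.sqrt_mul (sq_nonneg V),
      Real.sqrt_sq hV0.le]
  have hD : 0 < degree e i := by linarith
  have heq : ∑ j, convolution e i j * classSign (l j).1 - edgeContrast p q * classSign (l i).1 =
      (degree e i)⁻¹ * ((∑ j, adjacency e i j * classSign (l j).1 -
        n * ((p : ℝ) - q) / 2 * classSign (l i).1) -
        edgeContrast p q * classSign (l i).1 * (degree e i - V / 2)) := by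
    simp only [convolution_apply, mul_assoc, ← Finset.mul_sum]
    rw [← hΓ]
    field_simp
    ring
  rw [heq, abs_mul, abs_of_pos (inv_pos.2 hD), inv_mul_le_iff₀ hD]
  have h3 : |edgeContrast p q * classSign (l i).1 * (degree e i - V / 2)| ≤ 6 * √(V * ℓ) := by
    rw [abs_mul, abs_mul, abs_classSign, mul_one]
    exact (mul_le_of_le_one_left (abs_nonneg _) hΓ1).trans h1
  calc _ ≤ 6 * √(V * ℓ) + 6 * √(V * ℓ) := (abs_sub _ _).trans (add_le_add h2 h3)
    _ = V / 4 * (48 * √(ℓ / V)) := by rw [hroot]; ring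
    _ ≤ _ := by gcongr

lemma abs_convolution_sq_classSign_sub_le {Γ κ : ℝ} (hΓ : |Γ| ≤ 1)
    (h : ∀ i, |∑ j, convolution e i j * classSign (l j).1 - Γ * classSign (l i).1| ≤ κ)
    (i : Fin n) :
    |∑ j, (convolution e ^ 2) i j * classSign (l j).1 - Γ ^ 2 * classSign (l i).1| ≤ 2 * κ := by
  have heq : ∑ j, (convolution e ^ 2) i j * classSign (l j).1 - Γ ^ 2 * classSign (l i).1 =
      ∑ k, convolution e i k *
        (∑ j, convolution e k j * classSign (l j).1 - Γ * classSign (l k).1) +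
      Γ * (∑ k, convolution e i k * classSign (l k).1 - Γ * classSign (l i).1) := by
    have h1 : ∑ j, (convolution e ^ 2) i j * classSign (l j).1 =
        ∑ k, convolution e i k * ∑ j, convolution e k j * classSign (l j).1 := by
      simp only [pow_two, Matrix.mul_apply, Finset.sum_mul, Finset.mul_sum, mul_assoc]
      exact Finset.sum_comm
    simp only [h1, mul_sub, Finset.sum_sub_distrib, Finset.mul_sum]
    have h2 : ∑ k, convolution e i k * (Γ * classSign (l k).1) =
        ∑ k, Γ * (convolution e i k * classSign (l k).1) :=
      Finset.sum_congr rfl fun k _ => by ring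
    rw [h2]; ring
  have hκ : 0 ≤ κ := (abs_nonneg _).trans (h i)
  rw [heq, two_mul]
  refine (abs_add_le _ _).trans (add_le_add ?_ ?_)
  · calc _ ≤ ∑ k, convolution e i k * κ := by
          refine (Finset.abs_sum_le_sum_abs _ _).trans (Finset.sum_le_sum fun k _ => ?_)
          rw [abs_mul, abs_of_nonneg (convolution_nonneg e i k)]
          exact mul_le_mul_of_nonneg_left (h k) (convolution_nonneg e i k)
      _ ≤ κ := by
          rw [← Finset.sum_mul]
          exact mul_le_of_le_one_left hκ (sum_convolution_le_one e i)
  · rw [abs_mul]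
    exact (mul_le_of_le_one_left (abs_nonneg _) hΓ).trans (h i)

lemma sum_sq_convolution_le {V : ℝ} (hV : 0 < V) {i : Fin n} (hd : V / 4 ≤ degree e i) :
    ∑ j, convolution e i j ^ 2 ≤ 4 / V := by
  have hD : 0 < degree e i := by linarith
  have h : ∑ j, convolution e i j ^ 2 = (degree e i)⁻¹ := by
    simp only [convolution_apply, mul_pow, adjacency_sq, ← Finset.mul_sum]
    rw [← degree]
    field_simp
  rw [h, inv_le_comm₀ hD (by positivity), inv_div]
  exact hd

lemma sum_sq_convolution_sq_le {V : ℝ} (hV : 0 < V) (hd : ∀ i, V / 4 ≤ degree e i) {b : ℝ}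
    (hb : 1 ≤ b) {i : Fin n} (hco : ∀ j, j ≠ i → codegree e i j ≤ 3 * b) :
    ∑ j, (convolution e ^ 2) i j ^ 2 ≤ 80 * b / V ^ 2 + 16 / V ^ 2 := by
  have hD (k) : 0 < degree e k := by have := hd k; linarith
  have hinv (k) : (degree e k)⁻¹ ≤ 4 / V := by
    rw [inv_le_comm₀ (hD k) (by positivity), inv_div]; exact hd k
  have hdiag : (convolution e ^ 2) i i ≤ 4 / V := by
    rw [pow_two, Matrix.mul_apply]
    calc _ ≤ ∑ k, convolution e i k * (4 / V) := by
          refine Finset.sum_le_sum fun k _ => ?_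
          refine mul_le_mul_of_nonneg_left ?_ (convolution_nonneg e i k)
          rw [convolution_apply]
          exact (mul_le_of_le_one_right (inv_nonneg.2 (hD k).le) (adjacency_le_one e k i)).trans
            (hinv k)
      _ ≤ 4 / V := by
          rw [← Finset.sum_mul]
          exact mul_le_of_le_one_left (by positivity) (sum_convolution_le_one e i)
  have hoff (j) (hj : j ≠ i) : (convolution e ^ 2) i j ≤ 80 * b / V ^ 2 := by
    rw [pow_two, Matrix.mul_apply]
    have hfull : ∑ k, adjacency e i k * adjacency e k j ≤ 5 * b := by
      rw [← Finset.add_sum_erase _ _ (Finset.mem_univ i),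
        ← Finset.add_sum_erase _ _ (Finset.mem_erase.2 ⟨hj, Finset.mem_univ j⟩)]
      have := hco j hj
      rw [codegree] at this
      have h1 : adjacency e i i * adjacency e i j ≤ 1 :=
        mul_le_one₀ (adjacency_le_one e i i) (adjacency_nonneg e i j) (adjacency_le_one e i j)
      have h2 : adjacency e i j * adjacency e j j ≤ 1 :=
        mul_le_one₀ (adjacency_le_one e i j) (adjacency_nonneg e j j) (adjacency_le_one e j j)
      linarith
    calc _ ≤ ∑ k, (4 / V) ^ 2 * (adjacency e i k * adjacency e k j) := by
          refine Finset.sum_le_sum fun k _ => ?_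
          rw [convolution_apply, convolution_apply, mul_mul_mul_comm, pow_two]
          refine mul_le_mul_of_nonneg_right ?_
            (mul_nonneg (adjacency_nonneg e i k) (adjacency_nonneg e k j))
          exact mul_le_mul (hinv i) (hinv k) (inv_nonneg.2 (hD k).le) (by positivity)
      _ ≤ (4 / V) ^ 2 * (5 * b) := by rw [← Finset.mul_sum]; gcongr
      _ = 80 * b / V ^ 2 := by rw [div_pow]; ring
  rw [← Finset.add_sum_erase _ _ (Finset.mem_univ i), add_comm]
  refine add_le_add ?_ ?_
  · calc _ ≤ ∑ j ∈ Finset.univ.erase i, 80 * b / V ^ 2 * (convolution e ^ 2) i j := by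
          refine Finset.sum_le_sum fun j hj => ?_
          rw [pow_two ((convolution e ^ 2) i j)]
          exact mul_le_mul_of_nonneg_right (hoff j (Finset.ne_of_mem_erase hj))
            (convolution_pow_nonneg e 2 i j)
      _ ≤ ∑ j, 80 * b / V ^ 2 * (convolution e ^ 2) i j :=
          Finset.sum_le_sum_of_subset_of_nonneg (Finset.erase_subset _ _) fun j _ _ =>
            mul_nonneg (by positivity) (convolution_pow_nonneg e 2 i j)
      _ ≤ 80 * b / V ^ 2 := by
          rw [← Finset.mul_sum]
          exact mul_le_of_le_one_right (by positivity) (sum_convolution_sq_le_one e i)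
  · rw [show (16 : ℝ) / V ^ 2 = (4 / V) ^ 2 by rw [div_pow]; norm_num]
    exact pow_le_pow_left₀ (convolution_pow_nonneg e 2 i i) hdiag 2

end Typical

/-! ### Lipschitz functions of a Gaussian variable -/

lemma integrable_exp_mul_of_lipschitz {F : ℝ → ℝ} {L : ℝ}
    (hF : ∀ x y, |F x - F y| ≤ L * |x - y|) (hFm : Measurable F) (t : ℝ) :
    Integrable (fun x => Real.exp (t * F x)) (gaussianReal 0 1) := by
  have h : Integrable (fun x => Real.exp (t * F 0) * Real.exp (|t| * L * |x|))
      (gaussianReal 0 1) := by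
    refine Integrable.const_mul ?_ _
    exact integrable_exp_mul_abs (X := fun x => x) (integrable_exp_mul_gaussianReal _)
      (integrable_exp_mul_gaussianReal _)
  refine h.mono' (by fun_prop) (ae_of_all _ fun x => ?_)
  rw [Real.norm_of_nonneg (Real.exp_pos _).le, ← Real.exp_add]
  refine Real.exp_le_exp.2 ?_
  have h1 := hF x 0
  rw [sub_zero] at h1
  have h2 : t * (F x - F 0) ≤ |t| * (L * |x|) :=
    (le_abs_self _).trans ((abs_mul _ _).le.trans (by gcongr))
  linarith

lemma integral_exp_mul_mul_le_of_lipschitz {F : ℝ → ℝ} {L : ℝ} (hL : 0 ≤ L)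
    (hF : ∀ x y, |F x - F y| ≤ L * |x - y|) (hFm : Measurable F) (t : ℝ) :
    (∫ x, Real.exp (t * F x) ∂(gaussianReal 0 1)) *
      (∫ x, Real.exp (-t * F x) ∂(gaussianReal 0 1)) ≤ Real.exp (t ^ 2 * L ^ 2) := by
  set γ := gaussianReal 0 1
  have hi (t : ℝ) : Integrable (fun x => Real.exp (t * F x)) γ :=
    integrable_exp_mul_of_lipschitz hF hFm t
  have hg (t : ℝ) : Integrable (fun x => Real.exp (t * x)) γ := integrable_exp_mul_gaussianReal t
  have hgi (t : ℝ) : ∫ x, Real.exp (t * x) ∂γ = Real.exp (t ^ 2 / 2) := by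
    have := congrFun (mgf_fun_id_gaussianReal (μ := 0) (v := 1)) t
    simpa [mgf] using this
  have key : ∫ z : ℝ × ℝ, (Real.exp (t * F z.1) * Real.exp (-t * F z.2) +
      Real.exp (-t * F z.1) * Real.exp (t * F z.2)) ∂(γ.prod γ) ≤
      ∫ z : ℝ × ℝ, (Real.exp (t * L * z.1) * Real.exp (-(t * L) * z.2) +
      Real.exp (-(t * L) * z.1) * Real.exp (t * L * z.2)) ∂(γ.prod γ) := by
    refine integral_mono (((hi t).mul_prod (hi (-t))).add ((hi (-t)).mul_prod (hi t)))
      (((hg (t * L)).mul_prod (hg (-(t * L)))).add ((hg (-(t * L))).mul_prod (hg (t * L))))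
      fun z => ?_
    have hcosh (a b : ℝ) : Real.exp a * Real.exp (-b) + Real.exp (-a) * Real.exp b =
        2 * Real.cosh (a - b) := by
      rw [Real.cosh_eq, ← Real.exp_add, ← Real.exp_add]
      ring_nf
    have h1 := hcosh (t * F z.1) (t * F z.2)
    have h2 := hcosh (t * L * z.1) (t * L * z.2)
    simp only [neg_mul] at h1 h2 ⊢
    rw [h1, h2]
    have : Real.cosh (t * F z.1 - t * F z.2) ≤ Real.cosh (t * L * z.1 - t * L * z.2) := by
      rw [Real.cosh_le_cosh, ← mul_sub, ← mul_sub, abs_mul, abs_mul, abs_mul, abs_of_nonneg hL,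
        mul_assoc]
      exact mul_le_mul_of_nonneg_left (hF _ _) (abs_nonneg t)
    linarith
  rw [integral_add ((hi t).mul_prod (hi (-t))) ((hi (-t)).mul_prod (hi t)),
    integral_add ((hg (t * L)).mul_prod (hg (-(t * L)))) ((hg (-(t * L))).mul_prod (hg (t * L))),
    integral_prod_mul (fun x => Real.exp (t * F x)) fun x => Real.exp (-t * F x),
    integral_prod_mul (fun x => Real.exp (-t * F x)) fun x => Real.exp (t * F x),
    integral_prod_mul (fun x => Real.exp (t * L * x)) fun x => Real.exp (-(t * L) * x),
    integral_prod_mul (fun x => Real.exp (-(t * L) * x)) fun x => Real.exp (t * L * x), hgi, hgi, neg_sq,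
    ← Real.exp_add] at key
  have : (t * L) ^ 2 / 2 + (t * L) ^ 2 / 2 = t ^ 2 * L ^ 2 := by ring
  rw [this] at key
  linarith

lemma hasSubgaussianMGF_of_lipschitz {F : ℝ → ℝ} {L : ℝ≥0}
    (hF : ∀ x y, |F x - F y| ≤ L * |x - y|) (hFm : Measurable F) :
    HasSubgaussianMGF (fun x => F x - ∫ y, F y ∂(gaussianReal 0 1)) (2 * L ^ 2)
      (gaussianReal 0 1) := by
  set γ := gaussianReal 0 1
  set c := ∫ y, F y ∂γ with hc
  have hi (t : ℝ) : Integrable (fun x => Real.exp (t * F x)) γ :=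
    integrable_exp_mul_of_lipschitz hF hFm t
  have hFi : Integrable F γ := by
    have h : Integrable (fun x : ℝ => |F 0| + L * |x|) γ := by
      have : Integrable (fun x : ℝ => x) γ := (memLp_id_gaussianReal 1).integrable le_rfl
      exact (integrable_const _).add (this.abs.const_mul _)
    refine h.mono' hFm.aestronglyMeasurable (ae_of_all _ fun x => ?_)
    have h1 := hF x 0
    rw [sub_zero] at h1
    have := abs_sub_abs_le_abs_sub (F x) (F 0)
    rw [Real.norm_eq_abs]
    linarith
  have hrw (t x : ℝ) : Real.exp (t * (F x - c)) = Real.exp (-(t * c)) * Real.exp (t * F x) := by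
    rw [← Real.exp_add]; congr 1; ring
  refine ⟨fun t => ?_, fun t => ?_⟩
  · simp only [hrw]
    exact (hi t).const_mul _
  · simp only [mgf, hrw]
    rw [integral_const_mul]
    have hj : Real.exp (-(t * c)) ≤ ∫ x, Real.exp (-t * F x) ∂γ := by
      have h := convexOn_exp.map_integral_le (μ := γ) (f := fun x => -t * F x)
        Real.continuous_exp.continuousOn isClosed_univ (by simp) (hFi.const_mul _) (hi (-t))
      rwa [integral_const_mul, ← hc, neg_mul] at h
    calc _ ≤ (∫ x, Real.exp (-t * F x) ∂γ) * ∫ x, Real.exp (t * F x) ∂γ :=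
          mul_le_mul_of_nonneg_right hj (integral_nonneg fun _ => (Real.exp_pos _).le)
      _ ≤ Real.exp (t ^ 2 * L ^ 2) := by
          rw [mul_comm]
          exact integral_exp_mul_mul_le_of_lipschitz L.2 hF hFm t
      _ = _ := by congr 1; push_cast; ring

lemma HasSubgaussianMGF.mono {Ω : Type*} {mΩ : MeasurableSpace Ω} {ρ : Measure Ω} {X : Ω → ℝ}
    {c c' : ℝ≥0} (h : HasSubgaussianMGF X c ρ) (hc : c ≤ c') : HasSubgaussianMGF X c' ρ :=
  ⟨h.1, fun t => (h.2 t).trans (Real.exp_le_exp.2 (by gcongr))⟩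

/-! ### The features -/

section Features

variable {d : ℕ}

instance (m : EuclideanSpace ℝ (Fin d)) (σ : ℝ) : IsProbabilityMeasure (sphericalGaussian m σ) := by
  unfold sphericalGaussian
  exact Measure.isProbabilityMeasure_map (by fun_prop)

lemma map_inner_sphericalGaussian (m : EuclideanSpace ℝ (Fin d)) (σ : ℝ)
    {v : EuclideanSpace ℝ (Fin d)} (hv : ‖v‖ = 1) :
    (sphericalGaussian m σ).map (fun x => inner ℝ v x) =
      (gaussianReal 0 1).map (fun y => inner ℝ v m + σ * y) := by
  have h1 : (stdGaussian (EuclideanSpace ℝ (Fin d))).map (innerSL ℝ v) = gaussianReal 0 1 := by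
    rw [IsGaussian.map_eq_gaussianReal, integral_strongDual_stdGaussian,
      variance_dual_stdGaussian, innerSL_apply_norm, hv]
    simp
  rw [sphericalGaussian, ← h1, Measure.map_map (by fun_prop) (by fun_prop),
    Measure.map_map (by fun_prop) (by fun_prop)]
  congr 1
  ext g
  simp [inner_add_right, inner_smul_right]

/-- The mean of `|a + σ g|` for a standard Gaussian `g`. -/
noncomputable def foldedMean (a σ : ℝ) : ℝ := ∫ y, |a + σ * y| ∂(gaussianReal 0 1)

lemma foldedMean_neg (a σ : ℝ) : foldedMean (-a) σ = foldedMean a σ := by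
  have h : (gaussianReal 0 1).map (fun x => -x) = gaussianReal 0 1 := by
    rw [gaussianReal_map_neg, neg_zero]
  rw [foldedMean, ← h, integral_map (by fun_prop) (by fun_prop), foldedMean]
  congr 1
  ext y
  rw [← abs_neg]
  ring_nf

lemma hasSubgaussianMGF_abs_inner (m : EuclideanSpace ℝ (Fin d)) (σ : ℝ≥0)
    {v : EuclideanSpace ℝ (Fin d)} (hv : ‖v‖ = 1) :
    HasSubgaussianMGF (fun x => |inner ℝ v x| - foldedMean (inner ℝ v m) σ) (2 * σ ^ 2)
      (sphericalGaussian m σ) := by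
  have h := hasSubgaussianMGF_of_lipschitz (F := fun y => |inner ℝ v m + σ * y|) (L := σ)
    (fun x y => by
      refine (abs_abs_sub_abs_le_abs_sub _ _).trans_eq ?_
      rw [add_sub_add_left_eq_sub, ← mul_sub, abs_mul, NNReal.abs_eq]) (by fun_prop)
  rw [← HasSubgaussianMGF.id_map_iff (by fun_prop)] at h ⊢
  convert! h using 1
  have e1 : (sphericalGaussian m σ).map
      (fun x => |inner ℝ v x| - foldedMean (inner ℝ v m) σ) =
      ((sphericalGaussian m σ).map (fun x => inner ℝ v x)).map
        (fun u => |u| - foldedMean (inner ℝ v m) σ) := by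
    rw [Measure.map_map (by fun_prop) (by fun_prop)]; rfl
  rw [e1, map_inner_sphericalGaussian m σ hv, Measure.map_map (by fun_prop) (by fun_prop)]
  rfl

lemma norm_direction {v : EuclideanSpace ℝ (Fin d)} (hv : v ≠ 0) : ‖direction v‖ = 1 := by
  rw [direction, norm_smul, norm_inv, norm_norm, inv_mul_cancel₀ (norm_ne_zero_iff.2 hv)]

lemma inner_direction_self (v : EuclideanSpace ℝ (Fin d)) : inner ℝ (direction v) v = ‖v‖ := by
  rw [direction, inner_smul_left, real_inner_self_eq_norm_sq]
  rcases eq_or_ne ‖v‖ 0 with h | h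
  · simp [h]
  · simp; field_simp

/-- The gap `E|a + σ g| - E|σ g|` between the means of the two folded Gaussians. -/
noncomputable def foldedGap (a σ : ℝ) : ℝ := foldedMean a σ - foldedMean 0 σ

variable {μ ν : EuclideanSpace ℝ (Fin d)}

lemma foldedMean_sub_foldedMean (hnorm : ‖μ‖ = ‖ν‖) (horth : inner ℝ μ ν = 0) (σ : ℝ)
    (b : Bool × Bool) :
    foldedMean (inner ℝ (direction ν) (componentMean μ ν b.1 b.2)) σ -
      foldedMean (inner ℝ (direction μ) (componentMean μ ν b.1 b.2)) σ =
      foldedGap ‖μ‖ σ * classSign b.1 := by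
  have horth' : inner ℝ ν μ = 0 := by rw [real_inner_comm]; exact horth
  have h1 : inner ℝ (direction ν) μ = 0 := by rw [direction, inner_smul_left, horth', mul_zero]
  have h2 : inner ℝ (direction μ) ν = 0 := by rw [direction, inner_smul_left, horth, mul_zero]
  obtain ⟨ε, η⟩ := b
  cases ε <;> cases η <;>
    simp [componentMean, h1, h2, inner_direction_self, foldedGap,
      foldedMean_neg, hnorm, inner_neg_right]

lemma hasSubgaussianMGF_axisContrast (hμ : μ ≠ 0) (hν : ν ≠ 0) (hnorm : ‖μ‖ = ‖ν‖)
    (horth : inner ℝ μ ν = 0) (σ : ℝ≥0) (b : Bool × Bool) :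
    HasSubgaussianMGF (fun x => axisContrast μ ν x - foldedGap ‖μ‖ σ * classSign b.1)
      (8 * σ ^ 2) (sphericalGaussian (componentMean μ ν b.1 b.2) σ) := by
  have h1 := hasSubgaussianMGF_abs_inner (componentMean μ ν b.1 b.2) σ (norm_direction hν)
  have h2 := hasSubgaussianMGF_abs_inner (componentMean μ ν b.1 b.2) σ (norm_direction hμ)
  have h := h1.add h2.neg
  have hc : (NNReal.sqrt (2 * σ ^ 2) + NNReal.sqrt (2 * σ ^ 2)) ^ 2 = 8 * σ ^ 2 := by
    rw [← two_mul, mul_pow, NNReal.sq_sqrt]; ring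
  rw [hc] at h
  refine h.congr (ae_of_all _ fun x => ?_)
  have := foldedMean_sub_foldedMean hnorm horth σ b
  simp only [Pi.neg_apply, axisContrast]
  rw [← this]; ring

instance (μ ν : EuclideanSpace ℝ (Fin d)) (σ : ℝ) {n : ℕ} (l : Labels n) :
    IsProbabilityMeasure (featureLaw μ ν σ l) := by
  unfold featureLaw; infer_instance

lemma measurable_axisContrast : Measurable (axisContrast μ ν) := by
  unfold axisContrast; fun_prop

lemma featureLaw_sum_ge_le (hμ : μ ≠ 0) (hν : ν ≠ 0) (hnorm : ‖μ‖ = ‖ν‖)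
    (horth : inner ℝ μ ν = 0) {σ : ℝ} (hσ : 0 < σ) {n : ℕ} (l : Labels n) (w : Fin n → ℝ)
    {W ℓ : ℝ} (hW : 0 < W) (hwW : ∑ j, w j ^ 2 ≤ W) (hℓ : 0 ≤ ℓ) :
    (featureLaw μ ν σ l).real {x | 4 * σ * √(W * ℓ) ≤
      ∑ j, w j * (axisContrast μ ν (x j) - foldedGap ‖μ‖ σ * classSign (l j).1)} ≤
      Real.exp (-ℓ) := by
  lift σ to ℝ≥0 using hσ.le
  lift W to ℝ≥0 using hW.le
  have hind : iIndepFun (fun j (x : Features n d) => w j *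
      (axisContrast μ ν (x j) - foldedGap ‖μ‖ σ * classSign (l j).1)) (featureLaw μ ν σ l) :=
    iIndepFun_pi (X := fun j (x : EuclideanSpace ℝ (Fin d)) => w j *
      (axisContrast μ ν x - foldedGap ‖μ‖ σ * classSign (l j).1))
      fun j => ((measurable_axisContrast.sub_const _).const_mul _).aemeasurable
  obtain ⟨c, hc⟩ : ∃ c : Fin n → ℝ≥0, ∀ j, (c j : ℝ) = w j ^ 2 :=
    ⟨fun j => ⟨w j ^ 2, sq_nonneg _⟩, fun _ => rfl⟩
  have hsub (j : Fin n) : HasSubgaussianMGF (fun x : Features n d => w j *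
      (axisContrast μ ν (x j) - foldedGap ‖μ‖ σ * classSign (l j).1))
      (c j * (8 * σ ^ 2)) (featureLaw μ ν σ l) := by
    have hcj : c j = ⟨w j ^ 2, sq_nonneg _⟩ := NNReal.eq (hc j)
    rw [hcj]
    refine HasSubgaussianMGF.const_mul ?_ (w j)
    refine HasSubgaussianMGF.of_map (X := fun x => axisContrast μ ν x -
      foldedGap ‖μ‖ σ * classSign (l j).1) (Y := fun x : Features n d => x j)
      (measurable_pi_apply j).aemeasurable ?_
    rw [featureLaw, (measurePreserving_eval _ j).map_eq]
    exact hasSubgaussianMGF_axisContrast hμ hν hnorm horth σ (l j)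
  have hsum := HasSubgaussianMGF.sum_of_iIndepFun hind (s := Finset.univ) fun j _ => hsub j
  have hmono := HasSubgaussianMGF.mono hsum (c' := W * (8 * σ ^ 2)) (by
    rw [← Finset.sum_mul]
    gcongr
    rw [← NNReal.coe_le_coe]
    push_cast
    simpa only [hc] using hwW)
  refine (hmono.measure_ge_le (by positivity)).trans_eq ?_
  congr 1
  rw [mul_pow, mul_pow, Real.sq_sqrt (by positivity)]
  push_cast
  have : (0 : ℝ) < σ := hσ
  field_simp
  ring

lemma featureLaw_abs_sum_ge_le (hμ : μ ≠ 0) (hν : ν ≠ 0) (hnorm : ‖μ‖ = ‖ν‖)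
    (horth : inner ℝ μ ν = 0) {σ : ℝ} (hσ : 0 < σ) {n : ℕ} (l : Labels n) (w : Fin n → ℝ)
    {W ℓ : ℝ} (hW : 0 < W) (hwW : ∑ j, w j ^ 2 ≤ W) (hℓ : 0 ≤ ℓ) :
    (featureLaw μ ν σ l).real {x | 4 * σ * √(W * ℓ) ≤
      |∑ j, w j * (axisContrast μ ν (x j) - foldedGap ‖μ‖ σ * classSign (l j).1)|} ≤
      2 * Real.exp (-ℓ) := by
  have h1 := featureLaw_sum_ge_le hμ hν hnorm horth hσ l w hW hwW hℓ
  have h2 := featureLaw_sum_ge_le hμ hν hnorm horth hσ l (fun j => -w j) hW (by simpa using hwW) hℓ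
  simp only [neg_mul, Finset.sum_neg_distrib] at h2
  rw [two_mul (Real.exp (-ℓ))]
  refine le_trans ?_ (add_le_add h1 h2)
  refine le_trans (measureReal_mono ?_) (measureReal_union_le _ _)
  intro x hx
  simpa only [Set.mem_union, Set.mem_ofPred_eq, le_abs] using hx

end Features

/-! ### The gap between the folded means -/

/-- The average `2 ∫₀¹ (1 - u) φ(x u) du` of the Gaussian density `φ`. -/
noncomputable def tentAverage (x : ℝ) : ℝ :=
  2 * ∫ u in (0 : ℝ)..1, (1 - u) * gaussianPDFReal 0 1 (x * u)

lemma continuous_gaussianPDFReal_std : Continuous (gaussianPDFReal 0 1) := by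
  unfold gaussianPDFReal; fun_prop

lemma continuous_tentAverage : Continuous tentAverage := by
  have h := continuous_gaussianPDFReal_std
  refine continuous_const.mul ?_
  exact intervalIntegral.continuous_parametric_intervalIntegral_of_continuous'
    (f := fun x u => (1 - u) * gaussianPDFReal 0 1 (x * u)) (by fun_prop) 0 1

lemma gaussianPDFReal_one_le {x : ℝ} (h0 : 0 ≤ x) (h1 : x ≤ 1) :
    gaussianPDFReal 0 1 1 ≤ gaussianPDFReal 0 1 x := by
  simp only [gaussianPDFReal]
  gcongr

lemma div_le_tentAverage {x : ℝ} (hx : 0 ≤ x) :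
    gaussianPDFReal 0 1 1 / (1 + x) ≤ tentAverage x := by
  have hc := continuous_gaussianPDFReal_std
  have hcont : Continuous fun u => (1 - u) * gaussianPDFReal 0 1 (x * u) := by fun_prop
  set φ := gaussianPDFReal 0 1 1 with hφ
  have hφ0 : 0 ≤ φ := gaussianPDFReal_nonneg 0 1 1
  set b := (1 + x)⁻¹ with hb
  have hb0 : 0 < b := by positivity
  have hb1 : b ≤ 1 := inv_le_one_of_one_le₀ (by linarith)
  have hxb : x * b ≤ 1 := by
    rw [hb, ← div_eq_mul_inv]
    exact div_le_one_of_le₀ (by linarith) (by positivity)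
  have hsplit := intervalIntegral.integral_add_adjacent_intervals
    (hcont.intervalIntegrable (μ := volume) 0 b) (hcont.intervalIntegrable b 1)
  have h2 : 0 ≤ ∫ u in b..1, (1 - u) * gaussianPDFReal 0 1 (x * u) :=
    intervalIntegral.integral_nonneg hb1 fun u hu =>
      mul_nonneg (by linarith [hu.2]) (gaussianPDFReal_nonneg _ _ _)
  have h1 : ∫ u in (0 : ℝ)..b, (1 - u) * φ ≤
      ∫ u in (0 : ℝ)..b, (1 - u) * gaussianPDFReal 0 1 (x * u) := by
    refine intervalIntegral.integral_mono_on hb0.le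
      (Continuous.intervalIntegrable (by fun_prop) _ _) (hcont.intervalIntegrable _ _)
      fun u hu => ?_
    refine mul_le_mul_of_nonneg_left (gaussianPDFReal_one_le (mul_nonneg hx hu.1) ?_)
      (by linarith [hu.2])
    exact (mul_le_mul_of_nonneg_left hu.2 hx).trans hxb
  have h3 : ∫ u in (0 : ℝ)..b, (1 - u) * φ = (b - b ^ 2 / 2) * φ := by
    rw [intervalIntegral.integral_mul_const, intervalIntegral.integral_sub (by simp) (by simp)]
    simp
  rw [tentAverage, ← hsplit, div_eq_mul_inv, ← hb]
  nlinarith [mul_nonneg hφ0 (mul_nonneg hb0.le (sub_nonneg.2 hb1))]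

lemma foldedMean_eq_integral (a : ℝ) :
    foldedMean a 1 = ∫ y, |a + y| * gaussianPDFReal 0 1 y := by
  rw [foldedMean, integral_gaussianReal_eq_integral_smul one_ne_zero]
  simp [mul_comm]

lemma integrable_abs_add_mul_gaussianPDFReal (a : ℝ) :
    Integrable fun y => |a + y| * gaussianPDFReal 0 1 y := by
  have h : Integrable (fun y : ℝ => |a + y|) (gaussianReal 0 1) := by
    have : Integrable (fun x : ℝ => x) (gaussianReal 0 1) :=
      (memLp_id_gaussianReal 1).integrable le_rfl
    exact ((integrable_const a).add this).abs
  rw [gaussianReal_of_var_ne_zero _ one_ne_zero] at h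
  have h2 := (integrable_withDensity_iff_integrable_smul'
    (measurable_gaussianPDF 0 1) (ae_of_all _ fun _ => gaussianPDF_lt_top)).1 h
  refine h2.congr (ae_of_all _ fun y => ?_)
  simp [toReal_gaussianPDF, mul_comm]

lemma foldedGap_one {a : ℝ} (ha : 0 ≤ a) : foldedGap a 1 = a ^ 2 * tentAverage a := by
  have hφc := continuous_gaussianPDFReal_std
  have hφ (y : ℝ) : gaussianPDFReal 0 1 |y| = gaussianPDFReal 0 1 y := by
    simp [gaussianPDFReal]
  have h1 : foldedGap a 1 = ∫ y : ℝ, max (a - |y|) 0 * gaussianPDFReal 0 1 |y| := by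
    have e : foldedGap a 1 = ((foldedMean a 1 - foldedMean 0 1) +
        (foldedMean (-a) 1 - foldedMean 0 1)) / 2 := by rw [foldedMean_neg, foldedGap]; ring
    have i := integrable_abs_add_mul_gaussianPDFReal
    rw [e]
    simp only [foldedMean_eq_integral]
    have i2 (b : ℝ) : Integrable fun y : ℝ =>
        |b + y| * gaussianPDFReal 0 1 y - |0 + y| * gaussianPDFReal 0 1 y := (i b).sub (i 0)
    rw [← integral_sub (i a) (i 0), ← integral_sub (i (-a)) (i 0),
      ← integral_add (i2 a) (i2 (-a)), ← integral_div]
    congr 1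
    ext y
    rw [hφ]
    have : (|a + y| - |0 + y| + (|-a + y| - |0 + y|)) / 2 = max (a - |y|) 0 := by
      rw [zero_add]
      rcases le_total 0 y with hy | hy <;> rcases le_total a |y| with h | h
      · rw [abs_of_nonneg hy] at h ⊢
        rw [abs_of_nonneg (by linarith), abs_of_nonneg (by linarith), max_eq_right (by linarith)]
        ring
      · rw [abs_of_nonneg hy] at h ⊢
        rw [abs_of_nonneg (by linarith), abs_of_nonpos (by linarith), max_eq_left (by linarith)]
        ring
      · rw [abs_of_nonpos hy] at h ⊢
        rw [abs_of_nonpos (by linarith), abs_of_nonpos (by linarith), max_eq_right (by linarith)]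
        ring
      · rw [abs_of_nonpos hy] at h ⊢
        rw [abs_of_nonneg (by linarith), abs_of_nonpos (by linarith), max_eq_left (by linarith)]
        ring
    rw [← this]; ring
  have h2 : ∫ y in Set.Ioi (0 : ℝ), max (a - y) 0 * gaussianPDFReal 0 1 y =
      ∫ y in (0 : ℝ)..a, (a - y) * gaussianPDFReal 0 1 y := by
    rw [intervalIntegral.integral_of_le ha]
    have hzero : ∀ y ∈ Set.Ioi (0 : ℝ), y ∉ Set.Ioc (0 : ℝ) a →
        max (a - y) 0 * gaussianPDFReal 0 1 y = 0 := by
      intro y hy hy'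
      have : a < y := by
        by_contra h
        exact hy' ⟨hy, not_lt.1 h⟩
      rw [max_eq_right (by linarith), zero_mul]
    rw [setIntegral_eq_of_subset_of_forall_sdiff_eq_zero measurableSet_Ioi
      (fun y hy => hy.1) fun y hy => hzero y hy.1 hy.2]
    refine setIntegral_congr_fun measurableSet_Ioc fun y hy => ?_
    simp only [max_eq_left (sub_nonneg.2 hy.2)]
  have h3 : ∫ y in (0 : ℝ)..a, (a - y) * gaussianPDFReal 0 1 y =
      a ^ 2 * ∫ u in (0 : ℝ)..1, (1 - u) * gaussianPDFReal 0 1 (a * u) := by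
    have := intervalIntegral.smul_integral_comp_mul_left
      (f := fun y => (a - y) * gaussianPDFReal 0 1 y) (a := 0) (b := 1) a
    rw [mul_zero, mul_one] at this
    rw [← this, smul_eq_mul, pow_two, mul_assoc]
    congr 1
    rw [← intervalIntegral.integral_const_mul]
    refine intervalIntegral.integral_congr fun u _ => ?_
    ring
  rw [h1, integral_comp_abs (f := fun y => max (a - y) 0 * gaussianPDFReal 0 1 y), h2, h3,
    tentAverage]
  ring

lemma foldedMean_scale (a : ℝ) {σ : ℝ} (hσ : 0 < σ) :
    foldedMean a σ = σ * foldedMean (a / σ) 1 := by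
  rw [foldedMean, foldedMean, ← integral_const_mul]
  congr 1
  ext y
  rw [show a + σ * y = σ * (a / σ + 1 * y) by field_simp, abs_mul, abs_of_pos hσ]

lemma foldedGap_eq {a σ : ℝ} (ha : 0 ≤ a) (hσ : 0 < σ) :
    foldedGap a σ = σ * ((a / σ) ^ 2 * tentAverage (a / σ)) := by
  rw [← foldedGap_one (by positivity), foldedGap, foldedGap, foldedMean_scale a hσ,
    foldedMean_scale 0 hσ, zero_div]
  ring

/-! ### Bounding the probability of failure -/

lemma law_le_ofReal {n d : ℕ} (μ ν : EuclideanSpace ℝ (Fin d)) (σ : ℝ) (p q s : unitInterval)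
    (T : Set (Sample n d)) (BL : Finset (Labels n)) (BG : Labels n → Set (Graph n))
    (BF : Labels n → Graph n → Set (Features n d)) {a b c : ℝ} (ha : 0 ≤ a) (hb : 0 ≤ b)
    (hc : 0 ≤ c)
    (hT : ∀ S ∈ T, S.1 ∈ BL ∨ S.2.1 ∈ BG S.1 ∨ (S.2.1 ∉ BG S.1 ∧ S.2.2 ∈ BF S.1 S.2.1))
    (hL : (BL.card : ℝ) ≤ 4 ^ n * a)
    (hG : ∀ l, l ∉ BL → (graphLaw p q s l).real (BG l) ≤ b)
    (hF : ∀ l e, l ∉ BL → e ∉ BG l → (featureLaw μ ν σ l).real (BF l e) ≤ c) :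
    law n d μ ν σ p q s T ≤ ENNReal.ofReal (a + b + c) := by
  have hone (l : Labels n) : ((Measure.dirac l).prod
      ((graphLaw p q s l).prod (featureLaw μ ν σ l))) T ≤
      (if l ∈ BL then 1 else 0) + ENNReal.ofReal (b + c) := by
    by_cases hl : l ∈ BL
    · rw [if_pos hl]
      exact prob_le_one.trans le_self_add
    · rw [if_neg hl, zero_add]
      have hsub : T ⊆ ({l}ᶜ ×ˢ Set.univ) ∪ (Set.univ ×ˢ ((BG l ×ˢ Set.univ) ∪
          ⋃ e : {e : Graph n // e ∉ BG l}, {e.1} ×ˢ BF l e.1)) := by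
        rintro ⟨l', e, x⟩ hS
        by_cases hll : l' = l
        · subst hll
          right
          rcases hT _ hS with h | h | h
          · exact absurd h hl
          · exact ⟨trivial, Or.inl ⟨h, trivial⟩⟩
          · exact ⟨trivial, Or.inr (Set.mem_iUnion.2 ⟨⟨e, h.1⟩, rfl, h.2⟩)⟩
        · exact Or.inl ⟨hll, trivial⟩
      have hfeat : ((graphLaw p q s l).prod (featureLaw μ ν σ l))
          (⋃ e : {e : Graph n // e ∉ BG l}, {e.1} ×ˢ BF l e.1) ≤ ENNReal.ofReal c := by
        refine (measure_iUnion_le _).trans ?_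
        calc _ ≤ ∑' e : {e : Graph n // e ∉ BG l},
              graphLaw p q s l {e.1} * ENNReal.ofReal c := by
              refine ENNReal.tsum_le_tsum fun e => ?_
              rw [Measure.prod_prod]
              gcongr
              rw [← ofReal_measureReal]
              exact ENNReal.ofReal_le_ofReal (hF l e.1 hl e.2)
          _ ≤ ∑' e : Graph n, graphLaw p q s l {e} * ENNReal.ofReal c :=
              ENNReal.tsum_comp_le_tsum_of_injective Subtype.val_injective
                fun e => graphLaw p q s l {e} * ENNReal.ofReal c
          _ ≤ 1 * ENNReal.ofReal c := by
              rw [ENNReal.tsum_mul_right]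
              gcongr
              rw [tsum_fintype, sum_measure_singleton]
              exact prob_le_one
          _ = _ := one_mul _
      have hgraph : graphLaw p q s l (BG l) ≤ ENNReal.ofReal b := by
        rw [← ofReal_measureReal]
        exact ENNReal.ofReal_le_ofReal (hG l hl)
      refine (measure_mono hsub).trans ((measure_union_le _ _).trans ?_)
      rw [Measure.prod_prod, Measure.prod_prod, measure_univ, measure_univ, one_mul, mul_one,
        Measure.dirac_apply' _ (Set.toFinite _).measurableSet, Set.indicator_of_notMem (by simp),
        zero_add, ENNReal.ofReal_add hb hc]
      refine (measure_union_le _ _).trans (add_le_add ?_ hfeat)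
      rw [Measure.prod_prod, measure_univ, mul_one]
      exact hgraph
  have h4 : (4 : ℝ≥0∞) ^ n ≠ 0 := by simp
  have h4' : (4 : ℝ≥0∞) ^ n ≠ ⊤ := ENNReal.pow_ne_top (by simp)
  have hcard : (Fintype.card (Labels n) : ℝ≥0∞) = 4 ^ n := by
    simp [Labels]
  rw [law, Measure.finsetSum_apply]
  calc _ ≤ ∑ l : Labels n, ((4 : ℝ≥0∞) ^ n)⁻¹ *
        ((if l ∈ BL then 1 else 0) + ENNReal.ofReal (b + c)) := by
        refine Finset.sum_le_sum fun l _ => ?_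
        rw [Measure.smul_apply, smul_eq_mul]
        gcongr
        exact hone l
    _ = ((4 : ℝ≥0∞) ^ n)⁻¹ * (BL.card + 4 ^ n * ENNReal.ofReal (b + c)) := by
        rw [← Finset.mul_sum, Finset.sum_add_distrib, Finset.sum_const, nsmul_eq_mul,
          Finset.card_univ, hcard]
        simp
    _ ≤ ((4 : ℝ≥0∞) ^ n)⁻¹ * (4 ^ n * ENNReal.ofReal a + 4 ^ n * ENNReal.ofReal (b + c)) := by
        gcongr
        have h := ENNReal.ofReal_le_ofReal hL
        rwa [ENNReal.ofReal_natCast, ENNReal.ofReal_mul (by positivity),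
          ENNReal.ofReal_pow (by norm_num), ENNReal.ofReal_ofNat] at h
    _ = ENNReal.ofReal (a + b + c) := by
        rw [← mul_add, ← mul_assoc, ENNReal.inv_mul_cancel h4 h4', one_mul,
          ← ENNReal.ofReal_add ha (add_nonneg hb hc), add_assoc]

lemma law_le_one {n d : ℕ} (μ ν : EuclideanSpace ℝ (Fin d)) (σ : ℝ) (p q s : unitInterval)
    (T : Set (Sample n d)) : law n d μ ν σ p q s T ≤ 1 := by
  have h := law_le_ofReal μ ν σ p q s T Finset.univ (fun _ => ∅) (fun _ _ => ∅)
    zero_le_one le_rfl le_rfl (by simp) (by simp [Labels]) (by simp) (by simp)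
  simpa using h

lemma graphLaw_not_degreesConcentrate_le {n : ℕ} (p q s : unitInterval) (l : Labels n) {ℓ : ℝ}
    (hV : 0 < n * ((p : ℝ) + q)) (hℓ : 0 ≤ ℓ) (hℓV : ℓ ≤ n * ((p : ℝ) + q)) :
    (graphLaw p q s l).real {e | ¬ DegreesConcentrate p q s l e ℓ} ≤
      4 * n * Real.exp (-ℓ) := by
  have h (i : Fin n) (w : Fin n → ℝ) (hw : ∀ j, |w j| ≤ 1) :=
    graphLaw_abs_sum_ge_le p q s l i hw hV hℓ hℓV (sum_linkProb_le p q s l i)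
  have hsub : {e | ¬ DegreesConcentrate p q s l e ℓ} ⊆ ⋃ i : Fin n,
      ({e | 2 * √(n * ((p : ℝ) + q) * ℓ) ≤
        |∑ j ∈ Finset.univ.erase i, 1 * (adjacency e i j - linkProb p q s l i j)|} ∪
      {e | 2 * √(n * ((p : ℝ) + q) * ℓ) ≤
        |∑ j ∈ Finset.univ.erase i,
          classSign (l j).1 * (adjacency e i j - linkProb p q s l i j)|}) := by
    intro e he
    by_contra hcon
    simp only [Set.mem_iUnion, Set.mem_union, Set.mem_ofPred_eq, not_exists, not_or, not_le]
      at hcon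
    exact he fun i => ⟨(hcon i).1.le, (hcon i).2.le⟩
  refine (measureReal_mono hsub).trans ((measureReal_iUnion_fintype_le _).trans ?_)
  calc _ ≤ ∑ _i : Fin n, (2 * Real.exp (-ℓ) + 2 * Real.exp (-ℓ)) :=
        Finset.sum_le_sum fun i _ => (measureReal_union_le _ _).trans
          (add_le_add (h i (fun _ => 1) (by simp)) (h i _ fun j => (abs_classSign _).le))
    _ = _ := by simp; ring

lemma graphLaw_exists_codegree_ge_le {n : ℕ} (p q s : unitInterval) (l : Labels n) {ℓ : ℝ}
    (hℓ : ℓ ≤ n * ((p : ℝ) + q) ^ 2) :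
    (graphLaw p q s l).real
      {e | ∃ i j, j ≠ i ∧ 3 * (n * ((p : ℝ) + q) ^ 2) ≤ codegree e i j} ≤
      n ^ 2 * Real.exp (-ℓ) := by
  have hsub : {e : Graph n | ∃ i j, j ≠ i ∧ 3 * (n * ((p : ℝ) + q) ^ 2) ≤ codegree e i j} ⊆
      ⋃ i, ⋃ j, {e | j ≠ i ∧ 3 * (n * ((p : ℝ) + q) ^ 2) ≤ codegree e i j} := by
    rintro e ⟨i, j, h⟩
    exact Set.mem_iUnion.2 ⟨i, Set.mem_iUnion.2 ⟨j, h⟩⟩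
  refine (measureReal_mono hsub).trans ((measureReal_iUnion_fintype_le _).trans ?_)
  calc _ ≤ ∑ _i : Fin n, ∑ _j : Fin n, Real.exp (-ℓ) := by
        refine Finset.sum_le_sum fun i _ => (measureReal_iUnion_fintype_le _).trans
          (Finset.sum_le_sum fun j _ => ?_)
        by_cases hij : j = i
        · simp [hij, (Real.exp_pos _).le]
        · refine (measureReal_mono fun e he => ?_).trans
            (graphLaw_codegree_ge_le p q s l (Ne.symm hij) hℓ)
          exact he.2
    _ = _ := by simp; ring

lemma law_not_succeed_le {n d : ℕ} (hn : 0 < n) {μ ν : EuclideanSpace ℝ (Fin d)} (hμ : μ ≠ 0)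
    (hν : ν ≠ 0) (hnorm : ‖μ‖ = ‖ν‖) (horth : inner ℝ μ ν = 0) {R σ : ℝ} (hR : 0 < R)
    (hσ : 0 < σ) (p q s : unitInterval) (k : ℕ) {t ℓ W κ E η b : ℝ} (ht : |t| ≤ 1) (hℓ : 0 ≤ ℓ)
    (hV : 0 < n * ((p : ℝ) + q)) (hℓV : ℓ ≤ n * ((p : ℝ) + q)) (hW : 0 < W)
    (hgap : 0 ≤ foldedGap ‖μ‖ σ) (hE : 0 < E) (hη : η < 1)
    (hEeq : E = R / 32 * foldedGap ‖μ‖ σ * (t * edgeContrast p q ^ k))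
    (herr : R / 32 * (foldedGap ‖μ‖ σ * κ + 4 * σ * √(W * ℓ)) ≤ E * η)
    (BG : Labels n → Set (Graph n)) (hb : 0 ≤ b)
    (hBG : ∀ l, (graphLaw p q s l).real (BG l) ≤ b)
    (hgood : ∀ (l : Labels n) (e : Graph n), |∑ j, classSign (l j).1| ≤ √(2 * n * ℓ) →
      DegreesConcentrate p q s l e ℓ → e ∉ BG l → ∀ i,
        ∑ j, (convolution e ^ k) i j ^ 2 ≤ W ∧
        |∑ j, (convolution e ^ k) i j * classSign (l j).1 -
          edgeContrast p q ^ k * classSign (l i).1| ≤ κ) :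
    law n d μ ν σ p q s {S | ¬ Succeed (twoLayer μ ν R t) (threeLayer μ ν R t) k E η S} ≤
      ENNReal.ofReal ((2 + 6 * n) * Real.exp (-ℓ) + b) := by
  set BL := Finset.univ.filter fun l : Labels n => √(2 * n * ℓ) ≤ |∑ j, classSign (l j).1|
    with hBL
  have hBLmem (l) (hl : l ∉ BL) : |∑ j, classSign (l j).1| ≤ √(2 * n * ℓ) := by
    simp only [hBL, Finset.mem_filter, Finset.mem_univ, true_and, not_le] at hl
    exact hl.le
  have h := law_le_ofReal μ ν σ p q s
    {S | ¬ Succeed (twoLayer μ ν R t) (threeLayer μ ν R t) k E η S} BL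
    (fun l => {e | ¬ DegreesConcentrate p q s l e ℓ} ∪ BG l)
    (fun l e => ⋃ i, {x | 4 * σ * √(W * ℓ) ≤ |∑ j, (convolution e ^ k) i j *
      (axisContrast μ ν (x j) - foldedGap ‖μ‖ σ * classSign (l j).1)|})
    (a := 2 * Real.exp (-ℓ)) (b := 4 * n * Real.exp (-ℓ) + b) (c := 2 * n * Real.exp (-ℓ))
    (by positivity) (by positivity) (by positivity) ?_ (card_labels_le hn hℓ) ?_ ?_
  · refine h.trans_eq ?_
    congr 1
    ring
  · rintro ⟨l, e, x⟩ hS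
    by_contra hcon
    simp only [not_or, not_and, Set.mem_union, Set.mem_iUnion, Set.mem_ofPred_eq, not_exists,
      not_le, not_not] at hcon
    obtain ⟨hl, ⟨he, heB⟩, hx⟩ := hcon
    have hg := hgood l e (hBLmem l hl) he heB
    refine hS (succeed_of_close hn μ ν hR.le t k hE hη _ fun i => ?_)
    refine le_trans ?_ herr
    have hx := hx ⟨he, heB⟩ i
    have heq : t * R / 32 * ∑ j, (convolution e ^ k) i j * axisContrast μ ν (x j) -
        E * classSign (l i).1 = R / 32 * (t * (foldedGap ‖μ‖ σ *
          (∑ j, (convolution e ^ k) i j * classSign (l j).1 -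
            edgeContrast p q ^ k * classSign (l i).1) +
          ∑ j, (convolution e ^ k) i j *
            (axisContrast μ ν (x j) - foldedGap ‖μ‖ σ * classSign (l j).1))) := by
      have h1 : ∑ j, (convolution e ^ k) i j *
            (axisContrast μ ν (x j) - foldedGap ‖μ‖ σ * classSign (l j).1) =
          ∑ j, (convolution e ^ k) i j * axisContrast μ ν (x j) -
            foldedGap ‖μ‖ σ * ∑ j, (convolution e ^ k) i j * classSign (l j).1 := by
        rw [Finset.mul_sum, ← Finset.sum_sub_distrib]
        exact Finset.sum_congr rfl fun j _ => by ring
      rw [h1, hEeq]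
      ring
    show |t * R / 32 * ∑ j, (convolution e ^ k) i j * axisContrast μ ν (x j) -
        E * classSign (l i).1| ≤ _
    rw [heq, abs_mul, abs_of_pos (by positivity : 0 < R / 32), abs_mul]
    refine mul_le_mul_of_nonneg_left ?_ (by positivity)
    refine (mul_le_of_le_one_left (abs_nonneg _) ht).trans ((abs_add_le _ _).trans ?_)
    refine add_le_add ?_ hx.le
    rw [abs_mul, abs_of_nonneg hgap]
    exact mul_le_mul_of_nonneg_left (hg i).2 hgap
  · intro l _
    exact (measureReal_union_le _ _).trans
      (add_le_add (graphLaw_not_degreesConcentrate_le p q s l hV hℓ hℓV) (hBG l))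
  · intro l e hl he
    simp only [not_or, Set.mem_union, Set.mem_ofPred_eq, not_not] at he
    have hg := hgood l e (hBLmem l hl) he.1 he.2
    refine (measureReal_iUnion_fintype_le _).trans ?_
    calc _ ≤ ∑ _i : Fin n, 2 * Real.exp (-ℓ) := Finset.sum_le_sum fun i _ =>
          featureLaw_abs_sum_ge_le hμ hν hnorm horth hσ l _ hW (hg i).1 hℓ
      _ = _ := by simp; ring

/-! ### The error terms -/

/-- The factor in the exponent of the loss, as a function of `‖μ - ν‖ / σ`. -/
noncomputable def lossRate (r : ℝ) : ℝ := tentAverage (r / √2) / 64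

lemma continuous_lossRate : Continuous lossRate :=
  (continuous_tentAverage.comp (by fun_prop)).div_const 64

lemma gaussianPDFReal_one_pos : 0 < gaussianPDFReal 0 1 1 := gaussianPDFReal_pos 0 1 1 one_ne_zero

lemma div_le_lossRate {r : ℝ} (hr : 0 ≤ r) : gaussianPDFReal 0 1 1 / 64 / (1 + r) ≤ lossRate r := by
  have h2 : (1 : ℝ) ≤ √2 := Real.one_le_sqrt.2 (by norm_num)
  have h := div_le_tentAverage (x := r / √2) (by positivity)
  have h3 : gaussianPDFReal 0 1 1 / (1 + r) ≤ gaussianPDFReal 0 1 1 / (1 + r / √2) := by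
    refine div_le_div_of_nonneg_left gaussianPDFReal_one_pos.le (by positivity) ?_
    gcongr
    exact div_le_self hr h2
  rw [lossRate, div_right_comm]
  gcongr
  exact h3.trans h

section Geometry

variable {d : ℕ} {μ ν : EuclideanSpace ℝ (Fin d)}

lemma norm_sub_eq (hnorm : ‖μ‖ = ‖ν‖) (horth : inner ℝ μ ν = 0) : ‖μ - ν‖ = √2 * ‖μ‖ := by
  have h := norm_sub_sq_real μ ν
  rw [horth, ← hnorm] at h
  rw [← Real.sqrt_sq (norm_nonneg (μ - ν)), h,
    show ‖μ‖ ^ 2 - 2 * 0 + ‖μ‖ ^ 2 = 2 * ‖μ‖ ^ 2 by ring, Real.sqrt_mul (by norm_num),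
    Real.sqrt_sq (norm_nonneg μ)]

lemma lossRate_mul_eq (hnorm : ‖μ‖ = ‖ν‖) (horth : inner ℝ μ ν = 0) {σ : ℝ} (hσ : 0 < σ) (R : ℝ) :
    lossRate (‖μ - ν‖ / σ) * R * ‖μ - ν‖ ^ 2 / σ = R / 32 * foldedGap ‖μ‖ σ := by
  have h2 : √2 * ‖μ‖ / σ / √2 = ‖μ‖ / σ := by field_simp
  rw [norm_sub_eq hnorm horth, foldedGap_eq (norm_nonneg μ) hσ, lossRate, h2, mul_pow,
    Real.sq_sqrt (by norm_num)]
  field_simp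
  ring

end Geometry

section Errors

variable {κ₁ κ₂ c L ℓ V N σ a : ℝ}

lemma sqrt_div_le (hκ₁ : 0 < κ₁) (hc : 0 < c) (hL : 0 < L) (hℓ : ℓ = (c + 2) * L)
    (hV : κ₁ * L ^ 2 ≤ V) : √(ℓ / V) ≤ √(2 / κ₁) * √((1 + c) / L) := by
  rw [← Real.sqrt_mul (by positivity)]
  refine Real.sqrt_le_sqrt ?_
  have hV0 : 0 < V := lt_of_lt_of_le (by positivity) hV
  rw [hℓ, div_mul_div_comm, div_le_div_iff₀ hV0 (by positivity)]
  have h1 : (c + 2) * L * (κ₁ * L) ≤ 2 * (1 + c) * (κ₁ * L ^ 2) := by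
    have : 0 ≤ κ₁ * L ^ 2 * c := by positivity
    linarith
  exact h1.trans (by gcongr)

lemma sqrt_div_le_foldedGap (hκ₁ : 0 < κ₁) (hκ₂ : 0 < κ₂) (hc : 0 < c) (hL : 0 < L)
    (hℓ : ℓ = (c + 2) * L) (hV : κ₁ * L ^ 2 ≤ V) (hN : 0 < N) (hVN : V ≤ 2 * N) (hσ : 0 < σ)
    (ha : 0 ≤ a) (hγ : κ₂ * (σ * √L / N ^ (1 / 4 : ℝ)) ≤ √2 * a) :
    σ * √(ℓ / N) ≤ foldedGap a σ *
      (2 / gaussianPDFReal 0 1 1 * (3 / κ₂ ^ 2 + 2 / √κ₁) * √((1 + c) / L)) := by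
  set φ := gaussianPDFReal 0 1 1 with hφ
  have hφ0 : 0 < φ := gaussianPDFReal_one_pos
  set ε := √((1 + c) / L) with hε
  have hε0 : 0 ≤ ε := Real.sqrt_nonneg _
  have hε2 : ε ^ 2 = (1 + c) / L := Real.sq_sqrt (by positivity)
  set x := a / σ with hx
  have hx0 : 0 ≤ x := by positivity
  have hℓ0 : 0 < ℓ := by rw [hℓ]; positivity
  have hℓε : ℓ ≤ 2 * (ε * L) ^ 2 := by
    rw [mul_pow, hε2, hℓ]
    field_simp
    linarith
  have hsN : 0 < √N := Real.sqrt_pos.2 hN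
  have hquarter : (N ^ (1 / 4 : ℝ)) ^ 2 = √N := by
    rw [← Real.rpow_natCast, ← Real.rpow_mul hN.le, Real.sqrt_eq_rpow]
    norm_num
  have hx2 : κ₂ ^ 2 * L / (2 * √N) ≤ x ^ 2 := by
    have h := pow_le_pow_left₀ (by positivity) hγ 2
    rw [mul_pow, div_pow, mul_pow, hquarter, Real.sq_sqrt hL.le, mul_pow,
      Real.sq_sqrt (by norm_num)] at h
    rw [hx, div_pow, div_le_div_iff₀ (by positivity) (by positivity)]
    rw [← mul_div_assoc, div_le_iff₀ hsN] at h
    linarith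
  have hA : √(ℓ / N) ≤ x ^ 2 * (3 / κ₂ ^ 2 * ε) := by
    calc √(ℓ / N) = √ℓ / √N := Real.sqrt_div hℓ0.le N
      _ ≤ 3 / 2 * (ε * L) / √N := by
          gcongr
          rw [Real.sqrt_le_left (by positivity)]
          nlinarith [sq_nonneg (ε * L)]
      _ = κ₂ ^ 2 * L / (2 * √N) * (3 / κ₂ ^ 2 * ε) := by field_simp
      _ ≤ _ := by gcongr
  have hB : √(ℓ / N) ≤ 2 / √κ₁ * ε := by
    rw [Real.sqrt_le_left (by positivity), mul_pow, div_pow, Real.sq_sqrt hκ₁.le, hε2, hℓ,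
      div_mul_div_comm, div_le_div_iff₀ hN (by positivity)]
    have h1 : κ₁ * L ^ 2 ≤ 2 * N := hV.trans hVN
    have h2 : (c + 2) * (κ₁ * L ^ 2) ≤ (c + 2) * (2 * N) := by gcongr
    have h3 : 0 ≤ c * N := by positivity
    linarith
  have hH := div_le_tentAverage hx0
  rw [foldedGap_eq ha hσ, mul_assoc σ]
  refine mul_le_mul_of_nonneg_left ?_ hσ.le
  have hkey : √(ℓ / N) * (1 + x) ≤ x ^ 2 * (2 * (3 / κ₂ ^ 2 + 2 / √κ₁) * ε) := by
    have h1 : 1 + x ≤ 2 * (1 + x ^ 2) := by nlinarith [sq_nonneg (x - 1)]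
    calc √(ℓ / N) * (1 + x) ≤ √(ℓ / N) * (2 * (1 + x ^ 2)) := by gcongr
      _ = 2 * (√(ℓ / N) + x ^ 2 * √(ℓ / N)) := by ring
      _ ≤ 2 * (x ^ 2 * (3 / κ₂ ^ 2 * ε) + x ^ 2 * (2 / √κ₁ * ε)) := by gcongr
      _ = _ := by ring
  calc √(ℓ / N) = √(ℓ / N) * (1 + x) / (1 + x) := by field_simp
    _ ≤ x ^ 2 * (2 * (3 / κ₂ ^ 2 + 2 / √κ₁) * ε) / (1 + x) := by gcongr
    _ = x ^ 2 * (φ / (1 + x)) * (2 / φ * (3 / κ₂ ^ 2 + 2 / √κ₁) * ε) := by field_simp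
    _ ≤ _ := by gcongr

end Errors

/-- The constant in the relative error of the exponent; `g` is a lower bound for the contrast and
`w / N` an upper bound for the squared norms of the rows of the convolution matrix. -/
noncomputable def errorConstant (κ₁ κ₂ g w : ℝ) : ℝ :=
  (96 * √(2 / κ₁) +
    4 * √w * (2 / gaussianPDFReal 0 1 1 * (3 / κ₂ ^ 2 + 2 / √κ₁))) / g

lemma errorConstant_nonneg {κ₁ κ₂ g w : ℝ} (hg : 0 < g) :
    0 ≤ errorConstant κ₁ κ₂ g w := by
  have := gaussianPDFReal_one_pos
  unfold errorConstant
  positivity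

lemma weighted_error_le {κ₁ κ₂ g w G ε x y σ g' : ℝ} (hg : 0 < g) (hG : 0 ≤ G) (hε : 0 ≤ ε)
    (hgg : g ≤ g') (hx : x ≤ √(2 / κ₁) * ε)
    (hy : σ * y ≤ G * (2 / gaussianPDFReal 0 1 1 * (3 / κ₂ ^ 2 + 2 / √κ₁) * ε)) :
    G * (96 * x) + 4 * σ * (√w * y) ≤ G * g' * (errorConstant κ₁ κ₂ g w * ε) := by
  have hK := errorConstant_nonneg (κ₁ := κ₁) (κ₂ := κ₂) (w := w) hg
  have hKg : g * errorConstant κ₁ κ₂ g w = 96 * √(2 / κ₁) +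
      4 * √w * (2 / gaussianPDFReal 0 1 1 * (3 / κ₂ ^ 2 + 2 / √κ₁)) :=
    mul_div_cancel₀ _ hg.ne'
  have h1 : G * (96 * x) ≤ G * (96 * (√(2 / κ₁) * ε)) := by gcongr
  have h2 := mul_le_mul_of_nonneg_left hy (by positivity : 0 ≤ 4 * √w)
  have h3 : G * g * (errorConstant κ₁ κ₂ g w * ε) ≤ G * g' * (errorConstant κ₁ κ₂ g w * ε) := by
    gcongr
  have h4 : G * g * (errorConstant κ₁ κ₂ g w * ε) = G * ε * (g * errorConstant κ₁ κ₂ g w) := by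
    ring
  rw [hKg] at h4
  linarith

lemma union_bound_le {x c : ℝ} (hx : 1 ≤ x) :
    (2 + 6 * x) * Real.exp (-((c + 2) * Real.log x)) +
      x ^ 2 * Real.exp (-((c + 2) * Real.log x)) ≤ 9 * x ^ (-c) := by
  have hx0 : 0 < x := by linarith
  have hexp : Real.exp (-((c + 2) * Real.log x)) = x ^ (-c) / x ^ 2 := by
    rw [← Real.rpow_natCast, ← Real.rpow_sub hx0, Real.rpow_def_of_pos hx0]
    congr 1
    push_cast
    ring
  have hpos : 0 < x ^ (-c) := by positivity
  have h : 2 + 6 * x + x ^ 2 ≤ 9 * x ^ 2 := by nlinarith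
  rw [hexp, ← add_mul, ← mul_div_assoc, div_le_iff₀ (by positivity)]
  calc _ ≤ 9 * x ^ 2 * x ^ (-c) := by gcongr
    _ = _ := by ring

/-- The failure bound is trivial unless `log n` exceeds this constant times `1 + c`. -/
noncomputable def threshold (κ₁ κ₂ g w : ℝ) : ℝ :=
  1 + 1152 / κ₁ + errorConstant κ₁ κ₂ g w ^ 2 + 1 / κ₁ ^ 2

/-- The constant in the bound `O(n^(-c))` for the failure probability. -/
noncomputable def failureConstant (κ₁ κ₂ g w c : ℝ) : ℝ :=
  9 + Real.exp (threshold κ₁ κ₂ g w * (1 + c) * c)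

section Conclusion

variable {n d : ℕ} {μ ν : EuclideanSpace ℝ (Fin d)} {R σ κ₁ κ₂ g w c : ℝ}

lemma law_le_of_log_le (hn : 0 < n) (hc : 0 < c) (p q s : unitInterval) (T : Set (Sample n d))
    (hlog : Real.log n ≤ threshold κ₁ κ₂ g w * (1 + c)) :
    law n d μ ν σ p q s T ≤
      ENNReal.ofReal (failureConstant κ₁ κ₂ g w c * (n : ℝ) ^ (-c)) := by
  have hn' : (0 : ℝ) < n := by exact_mod_cast hn
  refine (law_le_one μ ν σ p q s T).trans ?_
  rw [← ENNReal.ofReal_one]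
  refine ENNReal.ofReal_le_ofReal ?_
  rw [Real.rpow_neg hn'.le, ← div_eq_mul_inv, le_div_iff₀ (by positivity), one_mul,
    Real.rpow_def_of_pos hn', failureConstant]
  have : Real.exp (Real.log n * c) ≤ Real.exp (threshold κ₁ κ₂ g w * (1 + c) * c) := by gcongr
  linarith

lemma law_not_succeed_le_rpow (hn : 0 < n) (hnorm : ‖μ‖ = ‖ν‖) (horth : inner ℝ μ ν = 0)
    (hR : 0 < R) (hσ : 0 < σ) (hκ₁ : 0 < κ₁) (hκ₂ : 0 < κ₂) (hg : 0 < g) (hw : 0 < w)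
    (hc : 0 < c) (p q s : unitInterval) (k : ℕ) {t N : ℝ} (ht : |t| ≤ 1)
    (hgt : g ≤ t * edgeContrast p q ^ k)
    (hV : κ₁ * Real.log n ^ 2 ≤ n * ((p : ℝ) + q)) (hN : 0 < N) (hVN : n * ((p : ℝ) + q) ≤ 2 * N)
    (hγ : κ₂ * (σ * √(Real.log n) / N ^ (1 / 4 : ℝ)) ≤ ‖μ - ν‖)
    (hlog : threshold κ₁ κ₂ g w * (1 + c) < Real.log n)
    (BG : Labels n → Set (Graph n))
    (hBG : ∀ l, (graphLaw p q s l).real (BG l) ≤ n ^ 2 * Real.exp (-((c + 2) * Real.log n)))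
    (hgood : ∀ (l : Labels n) (e : Graph n), e ∉ BG l →
      (∀ i, n * ((p : ℝ) + q) / 4 ≤ degree e i) →
      (∀ i, |∑ j, convolution e i j * classSign (l j).1 - edgeContrast p q * classSign (l i).1| ≤
        48 * √((c + 2) * Real.log n / (n * ((p : ℝ) + q)))) → ∀ i,
        ∑ j, (convolution e ^ k) i j ^ 2 ≤ w / N ∧
        |∑ j, (convolution e ^ k) i j * classSign (l j).1 -
          edgeContrast p q ^ k * classSign (l i).1| ≤
          96 * √((c + 2) * Real.log n / (n * ((p : ℝ) + q)))) :
    law n d μ ν σ p q s {S | ¬ Succeed (twoLayer μ ν R t) (threeLayer μ ν R t) k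
      (lossRate (‖μ - ν‖ / σ) * R * ‖μ - ν‖ ^ 2 / σ * (t * edgeContrast p q ^ k))
      (errorConstant κ₁ κ₂ g w * √((1 + c) / Real.log n)) S} ≤
      ENNReal.ofReal (failureConstant κ₁ κ₂ g w c * (n : ℝ) ^ (-c)) := by
  have hn' : (1 : ℝ) ≤ n := by exact_mod_cast hn
  set L := Real.log n with hLdef
  set K := errorConstant κ₁ κ₂ g w with hK
  have hK0 : 0 ≤ K := errorConstant_nonneg hg
  have hthr : 1 ≤ threshold κ₁ κ₂ g w := by
    have : 0 ≤ 1152 / κ₁ + errorConstant κ₁ κ₂ g w ^ 2 + 1 / κ₁ ^ 2 := by positivity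
    unfold threshold; linarith
  have hL1 : 1 + c ≤ L := (le_mul_of_one_le_left (by positivity) hthr).trans hlog.le
  have hL0 : 0 < L := by linarith
  have hLκ : 1152 / κ₁ * (1 + c) ≤ L := by
    refine le_trans (mul_le_mul_of_nonneg_right ?_ (by positivity)) hlog.le
    have : 0 ≤ 1 + errorConstant κ₁ κ₂ g w ^ 2 + 1 / κ₁ ^ 2 := by positivity
    unfold threshold; linarith
  have hLK : K ^ 2 * (1 + c) < L := by
    refine lt_of_le_of_lt (mul_le_mul_of_nonneg_right ?_ (by positivity)) hlog
    have : 0 ≤ 1 + 1152 / κ₁ + 1 / κ₁ ^ 2 := by positivity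
    unfold threshold; linarith
  set V := n * ((p : ℝ) + q) with hVdef
  have hV0 : 0 < V := lt_of_lt_of_le (by positivity) hV
  set ℓ := (c + 2) * L with hℓ
  have hℓ0 : 0 < ℓ := by positivity
  have hℓ2 : 2 ≤ ℓ := by nlinarith
  have hℓV : 576 * ℓ ≤ V := by
    refine le_trans ?_ hV
    have h1 : 1152 * (1 + c) ≤ κ₁ * L := by
      rw [div_mul_eq_mul_div, div_le_iff₀ hκ₁] at hLκ
      linarith
    have h2 : 1152 * (1 + c) * L ≤ κ₁ * L * L := by gcongr
    have h3 : 0 ≤ c * L := by positivity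
    rw [hℓ]
    linarith
  have hVℓ : 1 ≤ V * ℓ := by nlinarith
  have hμ : ‖μ‖ ≠ 0 := by
    intro h
    have : 0 < κ₂ * (σ * √L / N ^ (1 / 4 : ℝ)) := by positivity
    rw [norm_sub_eq hnorm horth, h, mul_zero] at hγ
    linarith
  have hμ0 : 0 < ‖μ‖ := (norm_nonneg μ).lt_of_ne' hμ
  have hgap : 0 < foldedGap ‖μ‖ σ := by
    rw [foldedGap_eq hμ0.le hσ]
    have h := div_le_tentAverage (x := ‖μ‖ / σ) (by positivity)
    have h2 : 0 < gaussianPDFReal 0 1 1 / (1 + ‖μ‖ / σ) :=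
      div_pos gaussianPDFReal_one_pos (by positivity)
    have h3 := h2.trans_le h
    positivity
  have hrate := lossRate_mul_eq hnorm horth hσ R
  set ε := √((1 + c) / L) with hε
  have herr1 := sqrt_div_le hκ₁ hc hL0 hℓ hV
  have herr2 := sqrt_div_le_foldedGap hκ₁ hκ₂ hc hL0 hℓ hV hN hVN hσ hμ0.le
    (by rwa [← norm_sub_eq hnorm horth])
  rw [hrate]
  have hη : K * ε < 1 := by
    rw [hε, ← Real.sqrt_sq hK0, ← Real.sqrt_mul (sq_nonneg K), Real.sqrt_lt' one_pos, one_pow,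
      ← mul_div_assoc, div_lt_one hL0]
    exact hLK
  have hfinal := law_not_succeed_le hn (norm_ne_zero_iff.1 hμ) (norm_ne_zero_iff.1 (hnorm ▸ hμ))
    hnorm horth hR hσ p q s k ht hℓ0.le hV0 (by linarith) (div_pos hw hN) hgap.le
    (κ := 96 * √(ℓ / V)) (η := K * ε)
    (E := R / 32 * foldedGap ‖μ‖ σ * (t * edgeContrast p q ^ k))
    (mul_pos (by positivity) (hg.trans_le hgt)) hη rfl ?_ BG (by positivity) hBG ?_
  · refine hfinal.trans (ENNReal.ofReal_le_ofReal ?_)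
    have hpos : 0 < (n : ℝ) ^ (-c) := by positivity
    refine (union_bound_le hn').trans (mul_le_mul_of_nonneg_right ?_ hpos.le)
    rw [failureConstant]
    have := Real.exp_pos (threshold κ₁ κ₂ g w * (1 + c) * c)
    linarith
  · have hroot : √(w / N * ℓ) = √w * √(ℓ / N) := by
      rw [← Real.sqrt_mul hw.le]; congr 1; ring
    rw [hroot, mul_assoc (R / 32), mul_assoc (R / 32)]
    refine mul_le_mul_of_nonneg_left ?_ (by positivity)
    exact weighted_error_le hg hgap.le (Real.sqrt_nonneg _) hgt herr1 herr2
  · intro l e hl he hB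
    exact hgood l e hB (quarter_le_degree hℓ0.le hVℓ hℓV hl he)
      (abs_convolution_classSign_sub_le hℓ0.le hVℓ hℓV hl he)

end Conclusion

lemma two_mul_le_add {x : ℝ} {p q : unitInterval} (hp : x ≤ p) (hq : x ≤ q) :
    2 * x ≤ (p : ℝ) + q := by linarith

lemma one_convolution_bound {n d : ℕ} {μ ν : EuclideanSpace ℝ (Fin d)} {R σ κ₁ κ₂ Γ₀ c : ℝ}
    (hn : 0 < n) (hnorm : ‖μ‖ = ‖ν‖) (horth : inner ℝ μ ν = 0)
    (hR : 0 < R) (hσ : 0 < σ) (hκ₁ : 0 < κ₁) (hκ₂ : 0 < κ₂) (hΓ₀ : 0 < Γ₀) (hc : 0 < c)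
    (p q s : unitInterval)
    (hp : κ₁ * (Real.log n ^ 2 / n) ≤ p) (hq : κ₁ * (Real.log n ^ 2 / n) ≤ q)
    (hΓ : Γ₀ ≤ |((p : ℝ) - q) / (p + q)|)
    (hγ : κ₂ * (σ * √(Real.log n) / (n * ((p : ℝ) + q)) ^ (1 / 4 : ℝ)) ≤ ‖μ - ν‖) :
    law n d μ ν σ p q s {S | ¬ Succeed (twoLayer μ ν R (SignType.sign ((p : ℝ) - q) : ℝ))
      (threeLayer μ ν R (SignType.sign ((p : ℝ) - q) : ℝ)) 1
      (lossRate (‖μ - ν‖ / σ) * R * ‖μ - ν‖ ^ 2 / σ * |((p : ℝ) - q) / (p + q)|)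
      (errorConstant κ₁ κ₂ Γ₀ 4 * √((1 + c) / Real.log n)) S} ≤
      ENNReal.ofReal (failureConstant κ₁ κ₂ Γ₀ 4 c * (n : ℝ) ^ (-c)) := by
  rcases le_or_gt (Real.log n) (threshold κ₁ κ₂ Γ₀ 4 * (1 + c)) with hlog | hlog
  · exact law_le_of_log_le hn hc p q s _ hlog
  have hn' : (0 : ℝ) < n := by exact_mod_cast hn
  have hπ0 : 0 ≤ (p : ℝ) + q := add_nonneg p.2.1 q.2.1
  have hπ : 0 < (p : ℝ) + q := hπ0.lt_of_ne' fun h => by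
    rw [h, div_zero, abs_zero] at hΓ
    linarith
  have hsign : (SignType.sign ((p : ℝ) - q) : ℝ) * edgeContrast p q ^ 1 =
      |((p : ℝ) - q) / (p + q)| := by
    rw [pow_one, edgeContrast, abs_div, abs_of_pos hπ, ← mul_div_assoc, sign_mul_self]
  have ht : |(SignType.sign ((p : ℝ) - q) : ℝ)| ≤ 1 := by
    cases SignType.sign ((p : ℝ) - q) <;> simp
  have hV0 : 0 < n * ((p : ℝ) + q) := by positivity
  have hV : κ₁ * Real.log n ^ 2 ≤ n * ((p : ℝ) + q) := by
    have h := mul_le_mul_of_nonneg_left (two_mul_le_add hp hq) hn'.le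
    have h2 : n * (2 * (κ₁ * (Real.log n ^ 2 / n))) = 2 * (κ₁ * Real.log n ^ 2) := by field_simp
    have h3 : 0 ≤ κ₁ * Real.log n ^ 2 := by positivity
    linarith
  rw [← hsign] at hΓ ⊢
  refine law_not_succeed_le_rpow hn hnorm horth hR hσ hκ₁ hκ₂ hΓ₀ (by norm_num) hc p q s 1 ht hΓ
    hV hV0 (by linarith) hγ hlog (fun _ => ∅) (fun l => ?_) ?_
  · rw [measureReal_empty]; positivity
  · intro l e _ hdeg hconv i
    simp only [pow_one]
    refine ⟨sum_sq_convolution_le hV0 (hdeg i), (hconv i).trans ?_⟩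
    gcongr
    norm_num

lemma two_convolutions_bound {n d : ℕ} {μ ν : EuclideanSpace ℝ (Fin d)} {R σ κ₁ κ₂ Γ₀ c : ℝ}
    (hn : 0 < n) (hnorm : ‖μ‖ = ‖ν‖) (horth : inner ℝ μ ν = 0)
    (hR : 0 < R) (hσ : 0 < σ) (hκ₁ : 0 < κ₁) (hκ₂ : 0 < κ₂) (hΓ₀ : 0 < Γ₀) (hc : 0 < c)
    (p q s : unitInterval)
    (hp : κ₁ * (Real.log n / √n) ≤ p) (hq : κ₁ * (Real.log n / √n) ≤ q)
    (hΓ : Γ₀ ≤ |((p : ℝ) - q) / (p + q)|)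
    (hγ : κ₂ * (σ * √(Real.log n) / (n : ℝ) ^ (1 / 4 : ℝ)) ≤ ‖μ - ν‖) :
    law n d μ ν σ p q s {S | ¬ Succeed (twoLayer μ ν R 1) (threeLayer μ ν R 1) 2
      (lossRate (‖μ - ν‖ / σ) * R * ‖μ - ν‖ ^ 2 / σ * (((p : ℝ) - q) / (p + q)) ^ 2)
      (errorConstant κ₁ κ₂ (Γ₀ ^ 2) (80 + 4 / κ₁ ^ 2) * √((1 + c) / Real.log n)) S} ≤
      ENNReal.ofReal
        (failureConstant κ₁ κ₂ (Γ₀ ^ 2) (80 + 4 / κ₁ ^ 2) c * (n : ℝ) ^ (-c)) := by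
  rcases le_or_gt (Real.log n) (threshold κ₁ κ₂ (Γ₀ ^ 2) (80 + 4 / κ₁ ^ 2) * (1 + c)) with
    hlog | hlog
  · exact law_le_of_log_le hn hc p q s _ hlog
  have hn' : (0 : ℝ) < n := by exact_mod_cast hn
  have hsn : 0 < √(n : ℝ) := Real.sqrt_pos.2 hn'
  have hsn2 : √(n : ℝ) ^ 2 = n := Real.sq_sqrt hn'.le
  have hthr : 1 + 1 / κ₁ ^ 2 ≤ threshold κ₁ κ₂ (Γ₀ ^ 2) (80 + 4 / κ₁ ^ 2) := by
    have : 0 ≤ 1152 / κ₁ + errorConstant κ₁ κ₂ (Γ₀ ^ 2) (80 + 4 / κ₁ ^ 2) ^ 2 := by positivity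
    unfold threshold; linarith
  have hL := (mul_le_mul_of_nonneg_right hthr (by positivity : 0 ≤ 1 + c)).trans hlog.le
  set L := Real.log n with hLdef
  have hL1 : 1 + c ≤ L := by
    have : 0 ≤ 1 / κ₁ ^ 2 * (1 + c) := by positivity
    linarith
  have hL0 : 0 < L := by linarith
  have hLκ : 1 + c ≤ κ₁ ^ 2 * L := by
    have h : 1 / κ₁ ^ 2 * (1 + c) ≤ L := by linarith
    rw [div_mul_eq_mul_div, one_mul, div_le_iff₀ (by positivity)] at h
    linarith
  have hπ := two_mul_le_add hp hq
  have hπ1 : 2 * κ₁ * L ≤ √n * ((p : ℝ) + q) := by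
    have h := mul_le_mul_of_nonneg_left hπ hsn.le
    have h2 : √n * (2 * (κ₁ * (L / √n))) = 2 * κ₁ * L := by field_simp
    linarith
  have hπ0 : 0 < (p : ℝ) + q := by
    have : 0 < √n * ((p : ℝ) + q) := lt_of_lt_of_le (by positivity) hπ1
    exact pos_of_mul_pos_right this hsn.le
  have hV0 : 0 < n * ((p : ℝ) + q) := by positivity
  have hVsq : 4 * κ₁ ^ 2 * L ^ 2 ≤ n * ((p : ℝ) + q) ^ 2 := by
    have h := pow_le_pow_left₀ (by positivity) hπ1 2
    rw [mul_pow (√(n : ℝ)), hsn2] at h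
    linarith
  have hLn : L ≤ 2 * √n := by
    have h := Real.log_le_sub_one_of_pos hsn
    rw [Real.log_sqrt hn'.le, ← hLdef] at h
    linarith
  have hV : κ₁ * L ^ 2 ≤ n * ((p : ℝ) + q) := by
    have h := mul_le_mul_of_nonneg_left hπ1 hsn.le
    rw [show √(n : ℝ) * (√n * ((p : ℝ) + q)) = √n ^ 2 * ((p : ℝ) + q) by ring, hsn2] at h
    have h2 : κ₁ * L * L ≤ κ₁ * L * (2 * √n) := by gcongr
    linarith
  have hVN : n * ((p : ℝ) + q) ≤ 2 * n := by
    have : (p : ℝ) + q ≤ 2 := by linarith [p.2.2, q.2.2]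
    nlinarith
  have hℓ : (c + 2) * L ≤ n * ((p : ℝ) + q) ^ 2 := by
    refine le_trans ?_ hVsq
    have h := mul_le_mul_of_nonneg_right hLκ hL0.le
    have h3 : 0 ≤ c * L := by positivity
    linarith
  have hb : 1 ≤ n * ((p : ℝ) + q) ^ 2 := le_trans (by nlinarith) hℓ
  have hone : (1 : ℝ) * edgeContrast p q ^ 2 = (((p : ℝ) - q) / (p + q)) ^ 2 := by
    rw [one_mul, edgeContrast]
  have hΓ2 : Γ₀ ^ 2 ≤ 1 * edgeContrast p q ^ 2 := by
    rw [hone, ← sq_abs (((p : ℝ) - q) / (p + q))]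
    gcongr
  rw [← hone]
  refine law_not_succeed_le_rpow hn hnorm horth hR hσ hκ₁ hκ₂ (by positivity) (by positivity) hc
    p q s 2 (by simp) hΓ2 hV hn' hVN hγ hlog
    (fun _ => {e | ∃ i j, j ≠ i ∧ 3 * (n * ((p : ℝ) + q) ^ 2) ≤ codegree e i j})
    (fun l => graphLaw_exists_codegree_ge_le p q s l hℓ) ?_
  intro l e he hdeg hconv i
  constructor
  · refine (sum_sq_convolution_sq_le hV0 hdeg hb fun j hj => ?_).trans ?_
    · by_contra h
      exact he ⟨i, j, hj, (not_le.1 h).le⟩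
    · have h1 : 80 * (n * ((p : ℝ) + q) ^ 2) / (n * ((p : ℝ) + q)) ^ 2 = 80 / n := by field_simp
      have h2 : 16 / (n * ((p : ℝ) + q)) ^ 2 ≤ 4 / κ₁ ^ 2 / n := by
        rw [div_div, div_le_div_iff₀ (by positivity) (by positivity)]
        have h3 : 4 * κ₁ ^ 2 * 1 ≤ 4 * κ₁ ^ 2 * L ^ 2 := by
          gcongr
          exact one_le_pow₀ (by linarith)
        have h4 : n * (4 * κ₁ ^ 2) ≤ n * (n * ((p : ℝ) + q) ^ 2) :=
          mul_le_mul_of_nonneg_left (by linarith) hn'.le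
        linarith
      rw [h1, add_div]
      gcongr
  · refine (abs_convolution_sq_classSign_sub_le (abs_edgeContrast_le_one p q) hconv i).trans_eq ?_
    ring

end XorCSBM

theorem theorem2 :
    -- the factor `C`, a universal positive continuous function of the ratio `‖μ - ν‖ / σ`
    ∃ C : ℝ → ℝ, ContinuousOn C (Set.Ici 0) ∧ (∃ c₀ > 0, ∀ r, 0 ≤ r → c₀ / (1 + r) ≤ C r) ∧
    -- one graph convolution
    (∀ κ₁ κ₂ Γ₀ : ℝ, 0 < κ₁ → 0 < κ₂ → 0 < Γ₀ →
      ∃ (K : ℝ) (M : ℝ → ℝ), ∀ (d : ℕ) (μ ν : EuclideanSpace ℝ (Fin d)) (R : ℝ),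
        ‖μ‖ = ‖ν‖ → inner ℝ μ ν = 0 → 0 < R →
        ∃ (θ₂ : SignType → XorCSBM.TwoLayer d) (θ₃ : SignType → XorCSBM.ThreeLayer d),
          (∀ ξ, (θ₂ ξ).Feasible R ∧ (θ₃ ξ).Feasible R) ∧
          ∀ (n : ℕ) (σ : ℝ) (p q s : unitInterval), 0 < n → 0 < σ →
            κ₁ * (Real.log n ^ 2 / n) ≤ p → κ₁ * (Real.log n ^ 2 / n) ≤ q →
            Γ₀ ≤ |((p : ℝ) - q) / (p + q)| →
            κ₂ * (σ * √(Real.log n) / (n * ((p : ℝ) + q)) ^ (1 / 4 : ℝ)) ≤ ‖μ - ν‖ →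
            ∀ c : ℝ, 0 < c →
              XorCSBM.law n d μ ν σ p q s
                {S | ¬ XorCSBM.Succeed (θ₂ (SignType.sign ((p : ℝ) - q)))
                  (θ₃ (SignType.sign ((p : ℝ) - q))) 1
                  (C (‖μ - ν‖ / σ) * R * ‖μ - ν‖ ^ 2 / σ * |((p : ℝ) - q) / (p + q)|)
                  (K * √((1 + c) / Real.log n)) S}
                ≤ ENNReal.ofReal (M c * (n : ℝ) ^ (-c))) ∧
    -- two graph convolutions
    (∀ κ₁ κ₂ Γ₀ : ℝ, 0 < κ₁ → 0 < κ₂ → 0 < Γ₀ →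
      ∃ (K : ℝ) (M : ℝ → ℝ), ∀ (d : ℕ) (μ ν : EuclideanSpace ℝ (Fin d)) (R : ℝ),
        ‖μ‖ = ‖ν‖ → inner ℝ μ ν = 0 → 0 < R →
        ∃ (θ₂ : XorCSBM.TwoLayer d) (θ₃ : XorCSBM.ThreeLayer d),
          (θ₂.Feasible R ∧ θ₃.Feasible R) ∧
          ∀ (n : ℕ) (σ : ℝ) (p q s : unitInterval), 0 < n → 0 < σ →
            κ₁ * (Real.log n / √n) ≤ p → κ₁ * (Real.log n / √n) ≤ q →
            Γ₀ ≤ |((p : ℝ) - q) / (p + q)| →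
            κ₂ * (σ * √(Real.log n) / (n : ℝ) ^ (1 / 4 : ℝ)) ≤ ‖μ - ν‖ →
            ∀ c : ℝ, 0 < c →
              XorCSBM.law n d μ ν σ p q s
                {S | ¬ XorCSBM.Succeed θ₂ θ₃ 2
                  (C (‖μ - ν‖ / σ) * R * ‖μ - ν‖ ^ 2 / σ * (((p : ℝ) - q) / (p + q)) ^ 2)
                  (K * √((1 + c) / Real.log n)) S}
                ≤ ENNReal.ofReal (M c * (n : ℝ) ^ (-c))) := by
  refine ⟨XorCSBM.lossRate, XorCSBM.continuous_lossRate.continuousOn,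
    ⟨gaussianPDFReal 0 1 1 / 64, div_pos XorCSBM.gaussianPDFReal_one_pos (by norm_num),
      fun r hr => XorCSBM.div_le_lossRate hr⟩, ?_, ?_⟩
  · intro κ₁ κ₂ Γ₀ hκ₁ hκ₂ hΓ₀
    refine ⟨XorCSBM.errorConstant κ₁ κ₂ Γ₀ 4, XorCSBM.failureConstant κ₁ κ₂ Γ₀ 4, ?_⟩
    intro d μ ν R hnorm horth hR
    refine ⟨fun ξ => XorCSBM.twoLayer μ ν R (ξ : ℝ), fun ξ => XorCSBM.threeLayer μ ν R (ξ : ℝ),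
      fun ξ => ?_, ?_⟩
    · have hξ : |(ξ : ℝ)| ≤ 1 := by cases ξ <;> simp
      exact ⟨XorCSBM.twoLayer_feasible μ ν hR.le hξ, XorCSBM.threeLayer_feasible μ ν hR.le hξ⟩
    · intro n σ p q s hn hσ hp hq hΓ hγ c hc
      exact XorCSBM.one_convolution_bound hn hnorm horth hR hσ hκ₁ hκ₂ hΓ₀ hc p q s hp hq hΓ hγ
  · intro κ₁ κ₂ Γ₀ hκ₁ hκ₂ hΓ₀
    refine ⟨XorCSBM.errorConstant κ₁ κ₂ (Γ₀ ^ 2) (80 + 4 / κ₁ ^ 2),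
      XorCSBM.failureConstant κ₁ κ₂ (Γ₀ ^ 2) (80 + 4 / κ₁ ^ 2), ?_⟩
    intro d μ ν R hnorm horth hR
    refine ⟨XorCSBM.twoLayer μ ν R 1, XorCSBM.threeLayer μ ν R 1,
      ⟨XorCSBM.twoLayer_feasible μ ν hR.le (by simp),
        XorCSBM.threeLayer_feasible μ ν hR.le (by simp)⟩, ?_⟩
    intro n σ p q s hn hσ hp hq hΓ hγ c hc
    exact XorCSBM.two_convolutions_bound hn hnorm horth hR hσ hκ₁ hκ₂ hΓ₀ hc p q s hp hq hΓ hγ
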